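/- Let $S=\{(x,y)\in\mathbb{R}^2 : -1\le x,y\le 1\}$. A homothetic packing of $n$ squares with radii $r_1,\dots,r_n>0$ is a family of squares $S_i=r_iS+p_i$ $(1\le i\le n)$, with centres $p_1,\dots,p_n\in\mathbb{R}^2$, whose interiors are pairwise disjoint. Its number of contacts is the number of unordered pairs $\{i,j\}$ with $i\ne j$ and $S_i\cap S_j\ne\emptyset$. Theorem. Let $n\ge 1$ and let $r_1,\dots,r_n$ be positive real numbers. Then the following statements are equivalent: (1) Every homothetic packing of $n$ squares with radii $r_1,\dots,r_n$ has at most $2n-2$ contacts. (2) Every function $\sigma:\{1,\dots,n\}\to\{-1,0,1\}$ which takes the value $0$ at least four times and satisfies $\sum_{i=1}^n\sigma_i r_i=0$ is the zero function. -/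

import Mathlib

/-- The standard square `{(x, y) : -1 ≤ x, y ≤ 1}` in the plane. -/
def stdSquare : Set (ℝ × ℝ) :=
  {z | (-1 ≤ z.1 ∧ z.1 ≤ 1) ∧ (-1 ≤ z.2 ∧ z.2 ≤ 1)}

/-- The set `r A + p = {r x + p : x ∈ A}`; for `r > 0` it is a homothetic copy of `A`. -/
def homotheticCopy (A : Set (ℝ × ℝ)) (r : ℝ) (p : ℝ × ℝ) : Set (ℝ × ℝ) :=
  {z | ∃ x ∈ A, z = r • x + p}

/-- A homothetic packing of `n` squares with radii `r 0, …, r (n - 1)`: squares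
`S_i = r_i S + p_i`, given by their centres `p_i`, with pairwise disjoint interiors. -/
structure HomotheticSquarePacking {n : ℕ} (r : Fin n → ℝ) where
  /-- The centres of the squares. -/
  center : Fin n → ℝ × ℝ
  radius_pos : ∀ i, 0 < r i
  disjoint_interiors : ∀ i j, i ≠ j →
    Disjoint (interior (homotheticCopy stdSquare (r i) (center i)))
      (interior (homotheticCopy stdSquare (r j) (center j)))

namespace HomotheticSquarePacking

/-- The `i`-th square of the packing. -/
def square {n : ℕ} {r : Fin n → ℝ} (P : HomotheticSquarePacking r) (i : Fin n) : Set (ℝ × ℝ) :=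
  homotheticCopy stdSquare (r i) (P.center i)

/-- The contact graph: `i` and `j` are adjacent iff `i ≠ j` and `S_i ∩ S_j` is non-empty. -/
def contactGraph {n : ℕ} {r : Fin n → ℝ} (P : HomotheticSquarePacking r) :
    SimpleGraph (Fin n) where
  Adj i j := i ≠ j ∧ (P.square i ∩ P.square j).Nonempty
  symm := ⟨fun _ _ h => ⟨h.1.symm, by rw [Set.inter_comm]; exact h.2⟩⟩
  loopless := ⟨fun _ h => h.1 rfl⟩

/-- The number of contacts, i.e. the number of edges of the contact graph. -/
noncomputable def numContacts {n : ℕ} {r : Fin n → ℝ} (P : HomotheticSquarePacking r) : ℕ :=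
  P.contactGraph.edgeSet.ncard

end HomotheticSquarePacking

/-- The weak generic condition: every `σ : [n] → {-1, 0, 1}` with at least four zeroes and
`∑ σ_i r_i = 0` is the zero function. -/
def WeakGeneric {n : ℕ} (r : Fin n → ℝ) : Prop :=
  ∀ σ : Fin n → ℤ, (∀ i, σ i = -1 ∨ σ i = 0 ∨ σ i = 1) →
    4 ≤ (Finset.univ.filter fun i => σ i = 0).card →
    ∑ i, (σ i : ℝ) * r i = 0 → ∀ i, σ i = 0

/-! Contacts split into horizontal ones (`SideContact`) and vertical ones (`SideContact` of `rot`);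
a corner contact belongs to exactly one type, decided by its diagonal direction. If both graphs are
forests, there are at most 2(n - 1) contacts.

Suppose the horizontal graph has a cycle. The left sides return to their start around it, which
gives a {-1, 0, 1}-relation between the radii that vanishes at the turns of the cycle and off the
cycle (`sum_turnSign_mul_eq_zero`). It is nontrivial, because a cycle turning at every square would
zigzag across a single vertical line, and the corner convention excludes this
(`no_alternating_sideContacts`). So it has at most three zeroes: the cycle turns exactly twice and
misses at most one square (`exists_twoChains_of_cycle`). It is thus a pair of chains from a leftmost
to a rightmost square. Comparing partial sums along them gives a second relation
(`left_U_eq_left_D`), which rules out alignments of their break points. Hence each square has at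
most one right neighbour on the chains, except for two at the leftmost and none at the rightmost
square. Moreover these two extreme squares have no vertical contact with the chains, and the
vertical graph is a forest. The few extra horizontal contacts are paid for by isolated vertices of
this forest (`TwoChains.card_add_card_rot_le`).

Conversely, a nontrivial relation says that two disjoint families have equal total width. Squares
are placed in two rows, above and below a horizontal line, always extending the shorter row, at two
contacts per square. Whenever both rows end at the same point, adding one square to each gains five
contacts instead of four. Two of the zeroes start the rows and two exploit the level reached after
the families are used up. The two gains raise 2n - 3 to 2n - 1. -/

open Finset

/-! ### Forests and cycles in graphs -/

/-- A relation without symmetric pairs whose underlying graph is a forest supported on a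
nonempty finite set `s` has at most `#s - 1` related pairs. -/
theorem card_rel_add_one_le_of_isAcyclic {V : Type*} [Fintype V] [DecidableEq V]
    (E : V → V → Prop) [DecidableRel E] (hE : ∀ i j, E i j → ¬ E j i)
    (hac : (SimpleGraph.fromRel E).IsAcyclic) (s : Finset V) (hs : s.Nonempty)
    (hsupp : ∀ i j, E i j → i ∈ s ∧ j ∈ s) :
    #{z : V × V | E z.1 z.2} + 1 ≤ #s := by
  classical
  have hne : ∀ i j, E i j → i ≠ j := fun i j h hij => by subst hij; exact hE _ _ h h
  have hac' : ((SimpleGraph.fromRel E).induce (s : Set V)).IsAcyclic := hac.induce _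
  have : Nonempty (s : Set V) := hs.to_subtype
  -- A maximal acyclic extension inside the complete graph on `s` is a spanning tree, whose edge
  -- count is known exactly.
  obtain ⟨T, hle, hT⟩ :=
    SimpleGraph.exists_maximal_isAcyclic_of_le_isAcyclic (G := ⊤) le_top hac'
  have hTree : T.IsTree := SimpleGraph.isTree_iff_maximal_isAcyclic.2 ⟨inferInstance, by
    refine ⟨hT.1.2, fun T' hT' hTT' => hT.2 ⟨le_top, hT'⟩ hTT'⟩⟩
  have hcard := hTree.card_edgeFinset
  have hcs : Fintype.card (s : Set V) = #s := by simp
  rw [hcs] at hcard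
  rw [← hcard]
  refine Nat.succ_le_succ ?_
  rw [← Fintype.card_coe, ← Fintype.card_coe]
  have hmem : ∀ z : {z // z ∈ ({z : V × V | E z.1 z.2} : Finset (V × V))}, E z.1.1 z.1.2 :=
    fun z => (mem_filter.1 z.2).2
  let f : {z // z ∈ ({z : V × V | E z.1 z.2} : Finset (V × V))} → {e // e ∈ T.edgeFinset} :=
    fun z => ⟨s(⟨z.1.1, (hsupp _ _ (hmem z)).1⟩, ⟨z.1.2, (hsupp _ _ (hmem z)).2⟩), by
      rw [SimpleGraph.mem_edgeFinset, SimpleGraph.mem_edgeSet]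
      apply hle
      simp only [SimpleGraph.comap_adj, SimpleGraph.fromRel_adj]
      exact ⟨hne _ _ (hmem z), Or.inl (hmem z)⟩⟩
  refine Fintype.card_le_of_injective f ?_
  rintro ⟨⟨a, b⟩, hz⟩ ⟨⟨c, d⟩, hz'⟩ h
  simp only [mem_filter, mem_univ, true_and] at hz hz'
  simp only [f, Subtype.mk.injEq, Sym2.eq_iff] at h
  rcases h with ⟨h1, h2⟩ | ⟨h1, h2⟩
  · subst h1 h2; rfl
  · subst h1 h2; exact absurd hz' (hE _ _ hz)

/-- A graph with a cycle contains an injective closed sequence of adjacent vertices. -/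
theorem exists_cyclic_sequence_of_not_isAcyclic {V : Type*} {G : SimpleGraph V}
    (h : ¬ G.IsAcyclic) :
    ∃ m : ℕ, 3 ≤ m ∧ ∃ v : ZMod m → V, Function.Injective v ∧ ∀ t, G.Adj (v t) (v (t + 1)) := by
  rw [SimpleGraph.isAcyclic_iff_free_cycleGraph] at h
  push Not at h
  obtain ⟨m, hm, hfree⟩ := h
  obtain ⟨k, rfl⟩ : ∃ k, m = k + 2 := ⟨m - 2, by omega⟩
  refine ⟨k + 2, hm, ?_⟩
  obtain ⟨⟨f, hf⟩⟩ := hfree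
  have key : ∀ t : Fin (k + 2), (SimpleGraph.cycleGraph (k + 2)).Adj t (t + 1) := fun t =>
    SimpleGraph.cycleGraph_adj.2 (Or.inr (add_sub_cancel_left _ _))
  exact ⟨f, hf, fun t => f.map_rel (key t)⟩

/-! ### Horizontal and vertical contacts -/

/-- A configuration of squares with radii `r`, any two separated horizontally or vertically. -/
structure SquareConfig {n : ℕ} (r : Fin n → ℝ) where
  x : Fin n → ℝ
  y : Fin n → ℝ
  pos : ∀ i, 0 < r i
  sep : ∀ i j, i ≠ j → x i + r i ≤ x j - r j ∨ x j + r j ≤ x i - r i ∨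
    y i + r i ≤ y j - r j ∨ y j + r j ≤ y i - r i

namespace SquareConfig

variable {n : ℕ} {r : Fin n → ℝ} (P : SquareConfig r)

/-- The configuration rotated by a quarter turn. -/
def rot : SquareConfig r where
  x := P.y
  y := fun i => -P.x i
  pos := P.pos
  sep i j hij := by
    rcases P.sep i j hij with h | h | h | h
    · right; right; right; linarith
    · right; right; left; linarith
    · left; exact h
    · right; left; exact h

/-- The right side of square `i` touches the left side of square `j`; a contact in a single
corner is allowed only if `j` lies above `i`. -/
def SideContact (i j : Fin n) : Prop :=
  P.x i + r i = P.x j - r j ∧ P.y i - r i < P.y j + r j ∧ P.y j - r j ≤ P.y i + r i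

variable {P}

theorem SideContact.not_symm {i j : Fin n} (h : P.SideContact i j) : ¬ P.SideContact j i := by
  intro h'
  have := h.1; have := h'.1; have := P.pos i; have := P.pos j
  linarith

/-- The strict inequalities in the two types of contact make them mutually exclusive, corners
included. -/
theorem SideContact.not_rot {i j : Fin n} (h : P.SideContact i j) :
    ¬ P.rot.SideContact i j := by
  intro h'
  obtain ⟨h1, h2, h3⟩ := h
  obtain ⟨h4, h5, h6⟩ := h'
  simp only [rot] at h4 h5 h6
  linarith

theorem SideContact.not_rot_symm {i j : Fin n} (h : P.SideContact i j) :
    ¬ P.rot.SideContact j i := by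
  intro h'
  obtain ⟨h1, h2, h3⟩ := h
  obtain ⟨h4, h5, h6⟩ := h'
  simp only [rot] at h4 h5 h6
  linarith

variable (P)

/-- Separation turns one of the touching inequalities into an equality. The only abutting position
that is not of the expected type is the excluded corner, and that corner is a contact of the other
type. -/
theorem sideContact_of_touch {i j : Fin n} (hij : i ≠ j)
    (h1 : P.x i - r i ≤ P.x j + r j) (h2 : P.x j - r j ≤ P.x i + r i)
    (h3 : P.y i - r i ≤ P.y j + r j) (h4 : P.y j - r j ≤ P.y i + r i) :
    (P.SideContact i j ∨ P.SideContact j i) ∨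
      (P.rot.SideContact i j ∨ P.rot.SideContact j i) := by
  have hi := P.pos i
  have hj := P.pos j
  have key : ∀ i j, 0 < r i → 0 < r j → P.x i + r i = P.x j - r j →
      P.y i - r i ≤ P.y j + r j → P.y j - r j ≤ P.y i + r i →
      P.SideContact i j ∨ P.rot.SideContact j i := by
    intro i j hi hj h1 h2 h3
    rcases h2.lt_or_eq with h | h
    · exact Or.inl ⟨h1, h, h3⟩
    · right
      refine ⟨?_, ?_, ?_⟩ <;> simp only [rot] <;> linarith
  have key' : ∀ i j, 0 < r i → 0 < r j → P.y i + r i = P.y j - r j →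
      P.x i - r i ≤ P.x j + r j → P.x j - r j ≤ P.x i + r i →
      P.rot.SideContact i j ∨ P.SideContact i j := by
    intro i j hi hj h1 h2 h3
    rcases h3.lt_or_eq with h | h
    · left
      refine ⟨?_, ?_, ?_⟩ <;> simp only [rot] <;> linarith
    · right
      refine ⟨?_, ?_, ?_⟩ <;> linarith
  rcases P.sep i j hij with h | h | h | h
  · have := key i j hi hj (le_antisymm h h2) h3 h4; tauto
  · have := key j i hj hi (le_antisymm h h1) h4 h3; tauto
  · have := key' i j hi hj (le_antisymm h h4) h1 h2; tauto
  · have := key' j i hj hi (le_antisymm h h3) h2 h1; tauto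

/-- Along a common vertical line there is no alternating family of side contacts: in a lowest
square of such a family two contacts would have to be corner contacts of both kinds. -/
theorem no_alternating_sideContacts (L R : Finset (Fin n)) (hL : L.Nonempty)
    (hLR : ∀ i ∈ L, ∃ j ∈ R, ∃ k ∈ R, j ≠ k ∧ P.SideContact i j ∧ P.SideContact i k)
    (hRL : ∀ j ∈ R, ∃ i ∈ L, ∃ k ∈ L, i ≠ k ∧ P.SideContact i j ∧ P.SideContact k j) :
    False := by
  obtain ⟨i, hi, hmin⟩ := exists_min_image (L ∪ R) (fun i => P.y i + r i)
    (hL.mono subset_union_left)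
  have hminL : ∀ j ∈ L, P.y i + r i ≤ P.y j + r j := fun j hj => hmin j (mem_union_left _ hj)
  have hminR : ∀ j ∈ R, P.y i + r i ≤ P.y j + r j := fun j hj => hmin j (mem_union_right _ hj)
  -- two squares of the right side touching a common left square are vertically separated
  have sepR : ∀ i j k, j ≠ k → P.SideContact i j → P.SideContact i k →
      P.y j + r j ≤ P.y k - r k ∨ P.y k + r k ≤ P.y j - r j := by
    intro i j k hjk h1 h2
    have := h1.1; have := h2.1; have := P.pos j; have := P.pos k
    rcases P.sep j k hjk with h | h | h | h
    · linarith
    · linarith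
    · exact Or.inl h
    · exact Or.inr h
  have sepL : ∀ i j k, j ≠ k → P.SideContact j i → P.SideContact k i →
      P.y j + r j ≤ P.y k - r k ∨ P.y k + r k ≤ P.y j - r j := by
    intro i j k hjk h1 h2
    have := h1.1; have := h2.1; have := P.pos j; have := P.pos k
    rcases P.sep j k hjk with h | h | h | h
    · linarith
    · linarith
    · exact Or.inl h
    · exact Or.inr h
  have caseR : ∀ a ∈ L, ∀ b ∈ L, i ∈ R → P.SideContact a i → P.SideContact b i →
      P.y a + r a ≤ P.y b - r b → False := by
    intro a ha b hb _ h1 h2 h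
    have := hminL a ha
    have := h2.2.1
    linarith
  -- Here the corner contact of `i` with `b` is allowed, so the heights only force `a` and `i` to
  -- have equal tops. The second left neighbour `k` of `a` cannot lie below `i` by minimality, and
  -- above `i` it would meet `a` in an excluded corner.
  have caseL : ∀ a ∈ R, ∀ b ∈ R, i ∈ L → P.SideContact i a → P.SideContact i b →
      P.y a + r a ≤ P.y b - r b → False := by
    intro a ha b hb hiL h1 h2 h
    have ha' := hminR a ha
    have hb' := h2.2.2
    obtain ⟨c, hc, d, hd, hcd, h3, h4⟩ := hRL a ha
    have hother : ∃ k ∈ L, k ≠ i ∧ P.SideContact k a := by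
      by_cases hci : c = i
      · exact ⟨d, hd, fun h => hcd (hci.trans h.symm), h4⟩
      · exact ⟨c, hc, hci, h3⟩
    obtain ⟨k, hk, hki, hka⟩ := hother
    have hk' := hminL k hk
    have := hka.2.1
    have := P.pos k
    have := P.pos i
    rcases sepL a k i hki hka h1 with h | h <;> linarith
  rcases mem_union.1 hi with hiL | hiR
  · obtain ⟨a, ha, b, hb, hab, h1, h2⟩ := hLR i hiL
    rcases sepR i a b hab h1 h2 with h | h
    · exact caseL a ha b hb hiL h1 h2 h
    · exact caseL b hb a ha hiL h2 h1 h
  · obtain ⟨a, ha, b, hb, hab, h1, h2⟩ := hRL i hiR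
    rcases sepL i a b hab h1 h2 with h | h
    · exact caseR a ha b hb hiR h1 h2 h
    · exact caseR b hb a ha hiR h2 h1 h

end SquareConfig

/-! ### Cycles of side contacts -/

/-- Under the weak generic condition a `{-1, 0, 1}`-relation vanishing on four indices is zero. -/
theorem WeakGeneric.eq_zero {n : ℕ} {r : Fin n → ℝ} (hW : WeakGeneric r) (σ : Fin n → ℤ)
    (h1 : ∀ i, σ i = -1 ∨ σ i = 0 ∨ σ i = 1) (h2 : ∑ i, (σ i : ℝ) * r i = 0)
    (Z : Finset (Fin n)) (hZ : 4 ≤ #Z) (hσ : ∀ i ∈ Z, σ i = 0) (i : Fin n) : σ i = 0 :=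
  hW σ h1 (hZ.trans (card_le_card fun j hj => by simp [hσ j hj])) h2 i

theorem ZMod.add_one_ne_sub_one {m : ℕ} (hm : 3 ≤ m) (t : ZMod m) : t + 1 ≠ t - 1 := by
  intro h
  have : ((2 : ℕ) : ZMod m) = 0 := by
    push_cast
    linear_combination h
  rw [ZMod.natCast_eq_zero_iff] at this
  exact absurd (Nat.le_of_dvd (by norm_num) this) (by omega)

namespace SquareConfig

variable {n : ℕ} {r : Fin n → ℝ} (P : SquareConfig r)

/-- Two chains of side contacts leading from a common first square to a common last square,
with no other square in common. -/
structure TwoChains where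
  U : ℕ → Fin n
  D : ℕ → Fin n
  p : ℕ
  q : ℕ
  p_pos : 0 < p
  q_pos : 0 < q
  three_le : 3 ≤ p + q
  U_chain : ∀ k < p, P.SideContact (U k) (U (k + 1))
  D_chain : ∀ k < q, P.SideContact (D k) (D (k + 1))
  first : U 0 = D 0
  last : U p = D q
  disj : ∀ i ≤ p, ∀ j ≤ q, U i = D j → (i = 0 ∧ j = 0) ∨ (i = p ∧ j = q)

variable {P}

/-- The squares on the two chains. -/
def TwoChains.verts (C : P.TwoChains) : Finset (Fin n) :=
  (range (C.p + 1)).image C.U ∪ (range (C.q + 1)).image C.D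

section cycle

variable {m : ℕ} (v : ZMod m → Fin n)

open Classical in
/-- The sign of the `t`-th square of a cycle of side contacts: `1` or `-1` where the cycle passes
through from left to right or from right to left, and `0` where it turns. -/
noncomputable def turnSign (P : SquareConfig r) (v : ZMod m → Fin n) (t : ZMod m) : ℤ :=
  (if P.SideContact (v t) (v (t + 1)) then 1 else 0) -
    (if P.SideContact (v (t - 1)) (v t) then 0 else 1)

theorem turnSign_mem (t : ZMod m) :
    turnSign P v t = -1 ∨ turnSign P v t = 0 ∨ turnSign P v t = 1 := by
  unfold turnSign
  split_ifs <;> simp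

theorem turnSign_eq_zero_iff (t : ZMod m) : turnSign P v t = 0 ↔
    (P.SideContact (v t) (v (t + 1)) ↔ ¬ P.SideContact (v (t - 1)) (v t)) := by
  unfold turnSign
  split_ifs <;> simp_all

variable {v}

/-- A step to the right moves the left side by the width of the square being left, a step to the
left by minus the width of the square being entered. These moves sum to zero around the cycle, and
collecting them by squares gives the signs. -/
theorem sum_turnSign_mul_eq_zero [NeZero m]
    (hadj : ∀ t, P.SideContact (v t) (v (t + 1)) ∨ P.SideContact (v (t + 1)) (v t)) :
    ∑ t, (turnSign P v t : ℝ) * r (v t) = 0 := by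
  classical
  have e1 : ∀ t, (turnSign P v t : ℝ) * r (v t) =
      (if P.SideContact (v t) (v (t + 1)) then r (v t) else 0) -
        (if P.SideContact (v (t - 1)) (v t) then 0 else r (v t)) := by
    intro t
    unfold turnSign
    split_ifs <;> simp
  have e2 : ∑ t, (if P.SideContact (v (t - 1)) (v t) then 0 else r (v t)) =
      ∑ t, (if P.SideContact (v t) (v (t + 1)) then 0 else r (v (t + 1))) := by
    rw [← Equiv.sum_comp (Equiv.addRight (1 : ZMod m))]
    simp
  have e3 : ∑ t, (P.x (v t) - r (v t)) = ∑ t, (P.x (v (t + 1)) - r (v (t + 1))) :=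
    (Equiv.sum_comp (Equiv.addRight (1 : ZMod m)) fun t => P.x (v t) - r (v t)).symm
  rw [sum_congr rfl fun t _ => e1 t, sum_sub_distrib, e2, ← sum_sub_distrib]
  have e4 : ∀ t, (if P.SideContact (v t) (v (t + 1)) then r (v t) else 0) -
      (if P.SideContact (v t) (v (t + 1)) then 0 else r (v (t + 1))) =
      ((P.x (v (t + 1)) - r (v (t + 1))) - (P.x (v t) - r (v t))) / 2 := by
    intro t
    split_ifs with h
    · have := h.1; linarith
    · have := ((hadj t).resolve_left h).1; linarith
  rw [sum_congr rfl fun t _ => e4 t, ← sum_div, sum_sub_distrib, e3]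
  simp

/-- The signs are carried to a function on all indices that is zero off the cycle, so squares missed
by the cycle count among the four zeroes. -/
theorem turnSign_eq_zero [NeZero m] (hW : WeakGeneric r) (hv : Function.Injective v)
    (hadj : ∀ t, P.SideContact (v t) (v (t + 1)) ∨ P.SideContact (v (t + 1)) (v t))
    (Z : Finset (Fin n)) (hZ : 4 ≤ #Z) (hσ : ∀ t, v t ∈ Z → turnSign P v t = 0) (t : ZMod m) :
    turnSign P v t = 0 := by
  classical
  set σ : Fin n → ℤ := fun i => ∑ t, if v t = i then turnSign P v t else 0 with hσdef
  have hσv : ∀ t, σ (v t) = turnSign P v t := by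
    intro t
    simp only [hσdef, hv.eq_iff]
    simp
  have hσ0 : ∀ i, (∀ t, v t ≠ i) → σ i = 0 := by
    intro i hi
    simp [hσdef, hi]
  have hsum : ∑ i, (σ i : ℝ) * r i = 0 := by
    rw [← sum_turnSign_mul_eq_zero hadj]
    simp only [hσdef, Int.cast_sum, sum_mul]
    rw [sum_comm]
    refine sum_congr rfl fun t _ => ?_
    rw [sum_eq_single (v t)]
    · simp
    · intro j _ hj
      simp [hj.symm]
    · simp
  rw [← hσv]
  refine hW.eq_zero σ ?_ hsum Z hZ ?_ _
  · intro i
    by_cases hi : ∃ t, v t = i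
    · obtain ⟨t, rfl⟩ := hi
      rw [hσv]; exact turnSign_mem v t
    · push Not at hi
      exact Or.inr (Or.inl (hσ0 i hi))
  · intro i hi
    by_cases h : ∃ t, v t = i
    · obtain ⟨t, rfl⟩ := h
      rw [hσv]; exact hσ t hi
    · push Not at h
      exact hσ0 i h

theorem exists_turnSign_ne_zero [NeZero m] (hm : 3 ≤ m) (hv : Function.Injective v)
    (hadj : ∀ t, P.SideContact (v t) (v (t + 1)) ∨ P.SideContact (v (t + 1)) (v t)) :
    ∃ t, turnSign P v t ≠ 0 := by
  classical
  by_contra! h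
  simp only [turnSign_eq_zero_iff] at h
  have h2 : ∀ t : ZMod m, v (t + 1) ≠ v (t - 1) := fun t ht =>
    ZMod.add_one_ne_sub_one hm t (hv ht)
  have hS : ∃ t, P.SideContact (v t) (v (t + 1)) := by
    by_contra! h'
    have := h 0
    have h0 := h' 0
    have h1 := h' (0 - 1)
    rw [sub_add_cancel] at h1
    tauto
  have hprev : ∀ t, P.SideContact (v t) (v (t + 1)) → P.SideContact (v t) (v (t - 1)) := by
    intro t ht
    have := hadj (t - 1)
    rw [sub_add_cancel] at this
    exact this.resolve_left ((h t).1 ht)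
  obtain ⟨t0, ht0⟩ := hS
  -- If every sign is zero, steps to the right and to the left alternate, and each square touches
  -- its two cycle neighbours on the same side.
  refine P.no_alternating_sideContacts
    (univ.filter (fun t => P.SideContact (v t) (v (t + 1))) |>.image v)
    (univ.filter (fun t => ¬ P.SideContact (v t) (v (t + 1))) |>.image v) ?_ ?_ ?_
  · exact ⟨v t0, mem_image_of_mem _ (by simpa using ht0)⟩
  · intro i hi
    obtain ⟨t, ht, rfl⟩ := mem_image.1 hi
    have ht : P.SideContact (v t) (v (t + 1)) := by simpa using ht
    refine ⟨v (t + 1), mem_image_of_mem _ ?_, v (t - 1), mem_image_of_mem _ ?_, h2 t, ht,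
      hprev t ht⟩
    · have := h (t + 1)
      rw [add_sub_cancel_right] at this
      simp only [mem_filter, mem_univ, true_and]
      tauto
    · simp only [mem_filter, mem_univ, true_and, sub_add_cancel]
      exact (h t).1 ht
  · intro i hi
    obtain ⟨t, ht, rfl⟩ := mem_image.1 hi
    have ht : ¬ P.SideContact (v t) (v (t + 1)) := by simpa using ht
    have hp : P.SideContact (v (t - 1)) (v t) := by
      have := h t; tauto
    refine ⟨v (t + 1), mem_image_of_mem _ ?_, v (t - 1), mem_image_of_mem _ ?_, h2 t,
      (hadj t).resolve_left ht, hp⟩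
    · have := h (t + 1)
      rw [add_sub_cancel_right] at this
      simp only [mem_filter, mem_univ, true_and]
      tauto
    · simpa using hp

/-- A cycle of side contacts misses at most one square and consists of two chains. -/
theorem exists_twoChains_of_cycle (hW : WeakGeneric r) (hm : 3 ≤ m) (hv : Function.Injective v)
    (hadj : ∀ t, P.SideContact (v t) (v (t + 1)) ∨ P.SideContact (v (t + 1)) (v t)) :
    (∀ i j, (∀ t, v t ≠ i) → (∀ t, v t ≠ j) → i = j) ∧
      ∃ C : P.TwoChains, ∀ t, v t ∈ C.verts := by
  classical
  have : NeZero m := ⟨by omega⟩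
  obtain ⟨t1, ht1⟩ := exists_turnSign_ne_zero hm hv hadj
  have hfew : ∀ Z : Finset (Fin n), (∀ t, v t ∈ Z → turnSign P v t = 0) → #Z ≤ 3 := by
    intro Z hZ
    by_contra! h
    exact ht1 (turnSign_eq_zero hW hv hadj Z h hZ t1)
  -- Numbering starts at a square with smallest left side: the cycle turns there, leaving and
  -- arriving on its right.
  obtain ⟨a, -, hmin⟩ := exists_min_image univ (fun t => P.x (v t) - r (v t))
    (univ_nonempty (α := ZMod m))
  have hmin' : ∀ t, P.x (v a) - r (v a) ≤ P.x (v t) - r (v t) := fun t => hmin t (mem_univ t)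
  have hinj : ∀ i j : ℕ, i < m → j < m → v (a + i) = v (a + j) → i = j := by
    intro i j hi hj h
    have h' : (i : ZMod m) = (j : ZMod m) := add_left_cancel (hv h)
    rw [ZMod.natCast_eq_natCast_iff'] at h'
    rwa [Nat.mod_eq_of_lt hi, Nat.mod_eq_of_lt hj] at h'
  have hmz : ((m : ℕ) : ZMod m) = 0 := ZMod.natCast_self m
  set S : ℕ → Prop := fun k => P.SideContact (v (a + k)) (v (a + k + 1)) with hSdef
  have hS0 : S 0 := by
    rcases hadj a with h | h
    · simpa [hSdef] using h
    · have := h.1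
      have := hmin' (a + 1)
      have := P.pos (v (a + 1))
      linarith
  have hcast : ∀ k : ℕ, 0 < k → a + ((k - 1 : ℕ) : ZMod m) + 1 = a + k := by
    intro k hk
    rw [Nat.cast_sub hk]
    push_cast
    ring
  have hSm : ¬ S (m - 1) := by
    intro h
    simp only [hSdef] at h
    rw [hcast m (by omega), hmz, add_zero] at h
    have h1 := h.1
    have := hmin' (a + ((m - 1 : ℕ) : ZMod m))
    have := P.pos (v (a + ((m - 1 : ℕ) : ZMod m)))
    linarith
  have hzero : ∀ k : ℕ, 0 < k → (S k ↔ ¬ S (k - 1)) → turnSign P v (a + k) = 0 := by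
    intro k hk h
    rw [turnSign_eq_zero_iff]
    simp only [hSdef] at h
    rw [hcast k hk] at h
    have : a + (k : ZMod m) - 1 = a + ((k - 1 : ℕ) : ZMod m) := by
      rw [← hcast k hk]; ring
    rw [this]
    exact h
  have hzero0 : turnSign P v (a + (0 : ℕ)) = 0 := by
    have h := hzero m (by omega) ?_
    · rw [hmz] at h
      simpa using h
    · have : S m := by simpa [hSdef] using hS0
      tauto
  have hex : ∃ k, ¬ S k := ⟨m - 1, hSm⟩
  set p := Nat.find hex with hp
  have hpS : ¬ S p := Nat.find_spec hex
  have hplt : ∀ k < p, S k := fun k hk => not_not.1 (Nat.find_min hex hk)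
  have hp0 : 0 < p := Nat.pos_of_ne_zero fun h => hpS (h ▸ hS0)
  have hpm : p ≤ m - 1 := Nat.find_min' hex hSm
  have hzerop : turnSign P v (a + p) = 0 :=
    hzero p hp0 (by have := hplt (p - 1) (by omega); tauto)
  -- A second run to the right would start at a turn `k1` and end at a turn `k2`; with 0 and `p`
  -- these are four zeroes.
  have hback : ∀ k, p ≤ k → k < m → ¬ S k := by
    intro k hk hkm hSk
    have hex1 : ∃ k, p ≤ k ∧ S k := ⟨k, hk, hSk⟩
    set k1 := Nat.find hex1 with hk1
    obtain ⟨hpk1, hSk1⟩ := Nat.find_spec hex1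
    rw [← hk1] at hpk1 hSk1
    have hk1k : k1 ≤ k := Nat.find_min' hex1 ⟨hk, hSk⟩
    have hpk1' : p < k1 := lt_of_le_of_ne hpk1 fun h => hpS (h ▸ hSk1)
    have hS1 : ¬ S (k1 - 1) := fun h => Nat.find_min hex1 (m := k1 - 1) (by omega) ⟨by omega, h⟩
    have hex2 : ∃ k, k1 ≤ k ∧ ¬ S k := ⟨m - 1, by omega, hSm⟩
    set k2 := Nat.find hex2 with hk2
    obtain ⟨hk12, hSk2⟩ := Nat.find_spec hex2
    rw [← hk2] at hk12 hSk2
    have hk2m : k2 ≤ m - 1 := Nat.find_min' hex2 ⟨by omega, hSm⟩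
    have hk12' : k1 < k2 := lt_of_le_of_ne hk12 fun h => hSk2 (h ▸ hSk1)
    have hS2 : S (k2 - 1) := by
      by_contra h
      exact Nat.find_min hex2 (m := k2 - 1) (by omega) ⟨by omega, h⟩
    have hcard : #(({0, p, k1, k2} : Finset ℕ).image fun k : ℕ => v (a + k)) = 4 := by
      rw [card_image_of_injOn]
      · rw [card_insert_of_notMem, card_insert_of_notMem, card_pair] <;> simp <;> omega
      · intro i hi j hj hij
        simp only [coe_insert, coe_singleton, Set.mem_insert_iff, Set.mem_singleton_iff] at hi hj
        exact hinj i j (by omega) (by omega) hij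
    have := hfew (({0, p, k1, k2} : Finset ℕ).image fun k : ℕ => v (a + k)) ?_
    · omega
    · intro t ht
      obtain ⟨k, hk, hkt⟩ := mem_image.1 ht
      rw [← hv hkt]
      simp only [mem_insert, mem_singleton] at hk
      rcases hk with rfl | rfl | rfl | rfl
      · exact hzero0
      · exact hzerop
      · exact hzero _ (by omega) (by tauto)
      · exact hzero _ (by omega) (by tauto)
  constructor
  · intro i j hi hj
    by_contra hij
    -- Two missed squares and the two turns would again be four zeroes.
    have h0p : v (a + (0 : ℕ)) ≠ v (a + p) := fun h => by
      have := hinj 0 p (by omega) (by omega) h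
      omega
    have := hfew {i, j, v (a + (0 : ℕ)), v (a + p)} ?_
    · rw [card_insert_of_notMem, card_insert_of_notMem, card_pair h0p] at this
      · omega
      · simp [(hj _).symm]
      · simp [hij, (hi _).symm]
    · intro t ht
      simp only [mem_insert, mem_singleton] at ht
      rcases ht with h | h | h | h
      · exact absurd h (hi t)
      · exact absurd h (hj t)
      · rw [hv h]; exact hzero0
      · rw [hv h]; exact hzerop
  · have hsub : ∀ k, k ≤ m → a - (k : ZMod m) = a + ((m - k : ℕ) : ZMod m) := by
      intro k hk
      rw [Nat.cast_sub hk, hmz]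
      ring
    refine ⟨⟨fun k => v (a + k), fun k => v (a - k), p, m - p, hp0, by omega, by omega,
      ?_, ?_, by simp, ?_, ?_⟩, ?_⟩
    · intro k hk
      have := hplt k hk
      simp only [hSdef] at this
      push_cast
      rw [← add_assoc]
      exact this
    · intro k hk
      have h := hback (m - (k + 1)) (by omega) (by omega)
      simp only [hSdef] at h
      rw [← hsub (k + 1) (by omega)] at h
      have h' := (hadj _).resolve_left h
      have e : a - ((k + 1 : ℕ) : ZMod m) + 1 = a - k := by push_cast; ring
      rw [e] at h'
      exact h'
    · rw [hsub _ (by omega)]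
      congr 3
      omega
    · intro i hi j hj h
      rw [hsub j (by omega)] at h
      rcases Nat.eq_zero_or_pos j with rfl | hj0
      · left
        rw [Nat.sub_zero, hmz] at h
        refine ⟨hinj i 0 (by omega) (by omega) ?_, rfl⟩
        simpa using h
      · right
        have := hinj i (m - j) (by omega) (by omega) h
        omega
    · intro t
      have ht : t = a + ((t - a).val : ℕ) := by
        rw [ZMod.natCast_zmod_val]; ring
      have hlt := ZMod.val_lt (t - a)
      set k := (t - a).val
      rw [ht]
      unfold TwoChains.verts
      by_cases hk : k ≤ p
      · exact mem_union_left _ (mem_image.2 ⟨k, by simp only [mem_range]; omega, rfl⟩)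
      · refine mem_union_right _ (mem_image.2 ⟨m - k, by simp only [mem_range]; omega, ?_⟩)
        simp only
        rw [hsub _ (by omega)]
        congr 3
        omega

end cycle

end SquareConfig

/-! ### Geometry of two chains -/

namespace SquareConfig

variable {n : ℕ} {r : Fin n → ℝ} {P : SquareConfig r}

namespace TwoChains

/-- Exchange the two chains. -/
def swap (C : P.TwoChains) : P.TwoChains where
  U := C.D
  D := C.U
  p := C.q
  q := C.p
  p_pos := C.q_pos
  q_pos := C.p_pos
  three_le := by have := C.three_le; omega
  U_chain := C.D_chain
  D_chain := C.U_chain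
  first := C.first.symm
  last := C.last.symm
  disj i hi j hj h := by
    have := C.disj j hj i hi h.symm
    tauto

variable (C : P.TwoChains)

theorem mem_verts_iff {i : Fin n} :
    i ∈ C.verts ↔ (∃ k ≤ C.p, C.U k = i) ∨ ∃ k ≤ C.q, C.D k = i := by
  simp [verts]

theorem right_U_le_left_U {i j : ℕ} (hij : i < j) (hj : j ≤ C.p) :
    P.x (C.U i) + r (C.U i) ≤ P.x (C.U j) - r (C.U j) := by
  induction j with
  | zero => omega
  | succ k ih =>
    have h := (C.U_chain k (by omega)).1
    rcases Nat.lt_succ_iff_lt_or_eq.1 hij with h' | rfl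
    · have := ih h' (by omega)
      have := P.pos (C.U k)
      linarith
    · exact h.le

theorem U_eq_of_left_eq {i j : ℕ} (hi : i ≤ C.p) (hj : j ≤ C.p)
    (h : P.x (C.U i) - r (C.U i) = P.x (C.U j) - r (C.U j)) : i = j := by
  have := P.pos (C.U i)
  have := P.pos (C.U j)
  rcases lt_trichotomy i j with h' | h' | h'
  · have := C.right_U_le_left_U h' hj
    linarith
  · exact h'
  · have := C.right_U_le_left_U h' hi
    linarith

theorem U_eq_of_right_eq {i j : ℕ} (hi : i ≤ C.p) (hj : j ≤ C.p)
    (h : P.x (C.U i) + r (C.U i) = P.x (C.U j) + r (C.U j)) : i = j := by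
  have := P.pos (C.U i)
  have := P.pos (C.U j)
  rcases lt_trichotomy i j with h' | h' | h'
  · have := C.right_U_le_left_U h' hj
    linarith
  · exact h'
  · have := C.right_U_le_left_U h' hi
    linarith

theorem U_injOn {i j : ℕ} (hi : i ≤ C.p) (hj : j ≤ C.p) (h : C.U i = C.U j) : i = j :=
  C.U_eq_of_left_eq hi hj (by rw [h])

/-- Consecutive squares abut, so widths telescope. The first square is kept apart because both
chains share it, and it cancels when they are compared. -/
theorem left_U_eq_sum {i : ℕ} (hi0 : 0 < i) (hi : i ≤ C.p) :
    P.x (C.U i) - r (C.U i) =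
      P.x (C.U 0) + r (C.U 0) + 2 * ∑ k ∈ (Ico 1 i).image C.U, r k := by
  rw [sum_image fun a ha b hb h => by
    simp only [coe_Ico, Set.mem_Ico] at ha hb
    exact C.U_injOn (by omega) (by omega) h]
  induction i with
  | zero => omega
  | succ k ih =>
    have h := (C.U_chain k (by omega)).1
    rcases Nat.eq_zero_or_pos k with rfl | hk
    · simpa using h.symm
    · rw [sum_Ico_succ_top (by omega)]
      have := ih hk (by omega)
      linarith

/-- Under the weak generic condition the two chains have no common break point except after
their first and before their last square. -/
theorem left_U_eq_left_D (hW : WeakGeneric r) {i j : ℕ} (hi0 : 0 < i) (hi : i ≤ C.p)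
    (hj0 : 0 < j) (hj : j ≤ C.q)
    (h : P.x (C.U i) - r (C.U i) = P.x (C.D j) - r (C.D j)) :
    (i = 1 ∧ j = 1) ∨ (i = C.p ∧ j = C.q) := by
  classical
  rcases hi.eq_or_lt with rfl | hip
  · right
    refine ⟨rfl, ?_⟩
    rw [C.last] at h
    exact (C.swap.U_eq_of_left_eq le_rfl hj h).symm
  rcases hj.eq_or_lt with rfl | hjq
  · right
    refine ⟨?_, rfl⟩
    rw [← C.last] at h
    exact C.U_eq_of_left_eq hi le_rfl h
  left
  set A := (Ico 1 i).image C.U with hA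
  set B := (Ico 1 j).image C.D with hB
  have hAsum := C.left_U_eq_sum hi0 hi
  have hBsum := C.swap.left_U_eq_sum hj0 hj
  simp only [swap] at hBsum
  rw [← hA] at hAsum
  rw [← hB] at hBsum
  have hAB : Disjoint A B := by
    rw [disjoint_left]
    intro k hk hk'
    obtain ⟨s, hs, rfl⟩ := mem_image.1 hk
    obtain ⟨t, ht, hst⟩ := mem_image.1 hk'
    rw [mem_Ico] at hs ht
    have := C.disj s (by omega) t (by omega) hst.symm
    omega
  have hsum : ∑ k ∈ A, r k = ∑ k ∈ B, r k := by
    rw [← C.first] at hBsum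
    linarith
  have hUA : ∀ k ≤ C.p, k = 0 ∨ i ≤ k → C.U k ∉ A := by
    intro k hk hk' hmem
    obtain ⟨s, hs, hsk⟩ := mem_image.1 hmem
    rw [mem_Ico] at hs
    have := C.U_injOn (by omega) hk hsk
    omega
  have hUB : ∀ k ≤ C.p, C.U k ∉ B := by
    intro k hk hmem
    obtain ⟨s, hs, hsk⟩ := mem_image.1 hmem
    rw [mem_Ico] at hs
    have := C.disj k hk s (by omega) hsk.symm
    omega
  have hDA : C.D j ∉ A := by
    intro hmem
    obtain ⟨s, hs, hsk⟩ := mem_image.1 hmem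
    rw [mem_Ico] at hs
    have := C.disj s (by omega) j hj hsk
    omega
  have hDB : C.D j ∉ B := by
    intro hmem
    obtain ⟨s, hs, hsk⟩ := mem_image.1 hmem
    rw [mem_Ico] at hs
    have := C.swap.U_injOn (i := s) (j := j) (by simp only [swap]; omega) hj hsk
    omega
  have hUD : ∀ k ≤ C.p, C.U k ≠ C.D j := by
    intro k hk hkj
    have := C.disj k hk j hj hkj
    omega
  set σ : Fin n → ℤ := fun k => (if k ∈ A then 1 else 0) - (if k ∈ B then 1 else 0) with hσ
  have hσ0 : ∀ k, k ∉ A → k ∉ B → σ k = 0 := fun k h1 h2 => by simp [hσ, h1, h2]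
  -- The zeroes are the two common ends and the two squares starting at the common break point; as
  -- `i < C.p` and `j < C.q`, they are distinct.
  have hz := hW.eq_zero σ ?_ ?_ {C.U 0, C.U i, C.U C.p, C.D j} ?_ ?_
  · constructor
    · by_contra hi1
      have h1 : C.U 1 ∈ A := mem_image_of_mem _ (by rw [mem_Ico]; omega)
      have := hz (C.U 1)
      simp [hσ, h1, disjoint_left.1 hAB h1] at this
    · by_contra hj1
      have h1 : C.D 1 ∈ B := mem_image_of_mem _ (by rw [mem_Ico]; omega)
      have := hz (C.D 1)
      simp [hσ, h1, disjoint_right.1 hAB h1] at this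
  · intro k
    simp only [hσ]
    split_ifs <;> simp
  · simp only [hσ, Int.cast_sub, sub_mul, sum_sub_distrib]
    simp [hsum]
  · rw [card_insert_of_notMem, card_insert_of_notMem, card_insert_of_notMem, card_singleton]
    · rw [mem_singleton]
      exact hUD _ le_rfl
    · simp only [mem_insert, mem_singleton, not_or]
      refine ⟨fun h => ?_, hUD i hi⟩
      have := C.U_injOn hi le_rfl h
      omega
    · simp only [mem_insert, mem_singleton, not_or]
      refine ⟨fun h => ?_, fun h => ?_, hUD 0 (by omega)⟩
      · have := C.U_injOn (by omega) hi h
        omega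
      · have := C.U_injOn (by omega) le_rfl h
        omega
  · intro k hk
    simp only [mem_insert, mem_singleton] at hk
    rcases hk with rfl | rfl | rfl | rfl
    · exact hσ0 _ (hUA _ (by omega) (by omega)) (hUB _ (by omega))
    · exact hσ0 _ (hUA _ (by omega) (by omega)) (hUB _ (by omega))
    · exact hσ0 _ (hUA _ (by omega) (by omega)) (hUB _ (by omega))
    · exact hσ0 _ hDA hDB

/-- The leftmost square of the two chains. -/
def leftmost : Fin n := C.U 0

/-- The rightmost square of the two chains. -/
def rightmost : Fin n := C.U C.p

theorem leftmost_ne_rightmost : C.leftmost ≠ C.rightmost := fun h => by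
  have := C.U_injOn (by omega) le_rfl h
  have := C.p_pos
  omega

theorem leftmost_mem : C.leftmost ∈ C.verts :=
  C.mem_verts_iff.2 (Or.inl ⟨0, by omega, rfl⟩)

theorem rightmost_mem : C.rightmost ∈ C.verts :=
  C.mem_verts_iff.2 (Or.inl ⟨C.p, le_rfl, rfl⟩)

theorem exists_ne_leftmost_ne_rightmost : ∃ i, i ≠ C.leftmost ∧ i ≠ C.rightmost := by
  have h3 := C.three_le
  by_cases hp : 2 ≤ C.p
  · refine ⟨C.U 1, fun h => ?_, fun h => ?_⟩
    · have := C.U_injOn (by omega) (by omega) h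
      omega
    · have := C.U_injOn (by omega) (by omega) h
      omega
  · refine ⟨C.D 1, fun h => ?_, fun h => ?_⟩
    · have := C.disj _ (by omega) 1 (by omega) h.symm
      omega
    · have := C.disj _ (by omega) 1 (by omega) h.symm
      omega

theorem eq_leftmost_or_right_le {i : Fin n} (hi : i ∈ C.verts) :
    i = C.leftmost ∨ P.x C.leftmost + r C.leftmost ≤ P.x i - r i := by
  rcases C.mem_verts_iff.1 hi with ⟨k, hk, rfl⟩ | ⟨k, hk, rfl⟩
  · rcases Nat.eq_zero_or_pos k with rfl | h0
    · exact Or.inl rfl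
    · exact Or.inr (C.right_U_le_left_U h0 hk)
  · rcases Nat.eq_zero_or_pos k with rfl | h0
    · exact Or.inl C.first.symm
    · right
      have := C.swap.right_U_le_left_U h0 hk
      rw [leftmost, C.first]
      exact this

theorem eq_rightmost_or_right_le {i : Fin n} (hi : i ∈ C.verts) :
    i = C.rightmost ∨ P.x i + r i ≤ P.x C.rightmost - r C.rightmost := by
  rcases C.mem_verts_iff.1 hi with ⟨k, hk, rfl⟩ | ⟨k, hk, rfl⟩
  · rcases hk.eq_or_lt with rfl | h0
    · exact Or.inl rfl
    · exact Or.inr (C.right_U_le_left_U h0 le_rfl)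
  · rcases hk.eq_or_lt with rfl | h0
    · exact Or.inl C.last.symm
    · right
      have := C.swap.right_U_le_left_U h0 le_rfl
      rw [rightmost, C.last]
      exact this

/-- A left side determines the position within one chain, so the two squares come from different
chains, and `left_U_eq_left_D` leaves only the break point next to the leftmost square. -/
theorem sideContact_leftmost_of_left_eq (hW : WeakGeneric r) {i j : Fin n} (hi : i ∈ C.verts)
    (hj : j ∈ C.verts) (hij : i ≠ j) (h : P.x i - r i = P.x j - r j) :
    P.SideContact C.leftmost i ∧ P.SideContact C.leftmost j := by
  have cross : ∀ k ≤ C.p, ∀ l ≤ C.q, C.U k ≠ C.D l →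
      P.x (C.U k) - r (C.U k) = P.x (C.D l) - r (C.D l) →
      P.SideContact C.leftmost (C.U k) ∧ P.SideContact C.leftmost (C.D l) := by
    intro k hk l hl hkl h
    rcases Nat.eq_zero_or_pos k with rfl | hk0
    · rw [C.first] at h
      rw [← C.swap.U_eq_of_left_eq (i := 0) (j := l) (by omega) hl h] at hkl
      exact absurd C.first hkl
    rcases Nat.eq_zero_or_pos l with rfl | hl0
    · rw [← C.first] at h
      rw [C.U_eq_of_left_eq hk (by omega) h] at hkl
      exact absurd C.first hkl
    rcases C.left_U_eq_left_D hW hk0 hk hl0 hl h with ⟨rfl, rfl⟩ | ⟨rfl, rfl⟩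
    · refine ⟨C.U_chain 0 C.p_pos, ?_⟩
      rw [leftmost, C.first]
      exact C.D_chain 0 C.q_pos
    · exact absurd C.last hkl
  rcases C.mem_verts_iff.1 hi with ⟨k, hk, rfl⟩ | ⟨k, hk, rfl⟩ <;>
    rcases C.mem_verts_iff.1 hj with ⟨l, hl, rfl⟩ | ⟨l, hl, rfl⟩
  · exact absurd (congrArg C.U (C.U_eq_of_left_eq hk hl h)) hij
  · exact cross k hk l hl hij h
  · exact (cross l hl k hk hij.symm h.symm).symm
  · exact absurd (congrArg C.D (C.swap.U_eq_of_left_eq hk hl h)) hij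

theorem sideContact_rightmost_of_right_eq (hW : WeakGeneric r) {i j : Fin n} (hi : i ∈ C.verts)
    (hj : j ∈ C.verts) (hij : i ≠ j) (h : P.x i + r i = P.x j + r j) :
    P.SideContact i C.rightmost ∧ P.SideContact j C.rightmost := by
  have cross : ∀ k ≤ C.p, ∀ l ≤ C.q, C.U k ≠ C.D l →
      P.x (C.U k) + r (C.U k) = P.x (C.D l) + r (C.D l) →
      P.SideContact (C.U k) C.rightmost ∧ P.SideContact (C.D l) C.rightmost := by
    intro k hk l hl hkl h
    rcases hk.eq_or_lt with rfl | hkp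
    · rw [C.last] at h
      rw [← C.swap.U_eq_of_right_eq (i := C.q) (j := l) le_rfl hl h] at hkl
      exact absurd C.last hkl
    rcases hl.eq_or_lt with rfl | hlq
    · rw [← C.last] at h
      rw [C.U_eq_of_right_eq hk le_rfl h] at hkl
      exact absurd C.last hkl
    have h1 := C.U_chain k hkp
    have h2 := C.D_chain l hlq
    rcases C.left_U_eq_left_D hW k.succ_pos hkp l.succ_pos hlq
      (by have := h1.1; have := h2.1; linarith) with ⟨hk1, hl1⟩ | ⟨hk1, hl1⟩
    · have hk0 : k = 0 := by omega
      have hl0 : l = 0 := by omega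
      subst hk0 hl0
      exact absurd C.first hkl
    · rw [show k + 1 = C.p from hk1] at h1
      rw [show l + 1 = C.q from hl1, ← C.last] at h2
      exact ⟨h1, h2⟩
  rcases C.mem_verts_iff.1 hi with ⟨k, hk, rfl⟩ | ⟨k, hk, rfl⟩ <;>
    rcases C.mem_verts_iff.1 hj with ⟨l, hl, rfl⟩ | ⟨l, hl, rfl⟩
  · exact absurd (congrArg C.U (C.U_eq_of_right_eq hk hl h)) hij
  · exact cross k hk l hl hij h
  · exact (cross l hl k hk hij.symm h.symm).symm
  · exact absurd (congrArg C.D (C.swap.U_eq_of_right_eq hk hl h)) hij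

theorem exists_sideContact_leftmost : ∃ i ∈ C.verts, P.SideContact C.leftmost i :=
  ⟨C.U 1, C.mem_verts_iff.2 (Or.inl ⟨1, C.p_pos, rfl⟩), C.U_chain 0 C.p_pos⟩

theorem exists_sideContact_rightmost : ∃ i ∈ C.verts, P.SideContact i C.rightmost := by
  refine ⟨C.U (C.p - 1), C.mem_verts_iff.2 (Or.inl ⟨C.p - 1, by omega, rfl⟩), ?_⟩
  have h := C.U_chain (C.p - 1) (by have := C.p_pos; omega)
  rwa [Nat.sub_add_cancel C.p_pos] at h

theorem sideContact_leftmost_of_left_eq_right (hW : WeakGeneric r) {i : Fin n}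
    (hi : i ∈ C.verts) (h : P.x i - r i = P.x C.leftmost + r C.leftmost) :
    P.SideContact C.leftmost i := by
  obtain ⟨j, hj, hc⟩ := C.exists_sideContact_leftmost
  by_cases hij : i = j
  · rwa [hij]
  · exact (C.sideContact_leftmost_of_left_eq hW hi hj hij (h.trans hc.1)).1

theorem sideContact_rightmost_of_right_eq_left (hW : WeakGeneric r) {i : Fin n}
    (hi : i ∈ C.verts) (h : P.x i + r i = P.x C.rightmost - r C.rightmost) :
    P.SideContact i C.rightmost := by
  obtain ⟨j, hj, hc⟩ := C.exists_sideContact_rightmost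
  by_cases hij : i = j
  · rwa [hij]
  · exact (C.sideContact_rightmost_of_right_eq hW hi hj hij (h.trans hc.1.symm)).1

/-- The smallest alternating family, a cycle of length four. -/
theorem _root_.SquareConfig.not_four_sideContacts {a b c d : Fin n} (hab : a ≠ b) (hcd : c ≠ d)
    (hac : P.SideContact a c) (had : P.SideContact a d) (hbc : P.SideContact b c)
    (hbd : P.SideContact b d) : False := by
  refine P.no_alternating_sideContacts {a, b} {c, d} ⟨a, by simp⟩ ?_ ?_
  · intro i hi
    refine ⟨c, by simp, d, by simp, hcd, ?_⟩
    simp only [mem_insert, mem_singleton] at hi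
    rcases hi with rfl | rfl
    · exact ⟨hac, had⟩
    · exact ⟨hbc, hbd⟩
  · intro i hi
    refine ⟨a, by simp, b, by simp, hab, ?_⟩
    simp only [mem_insert, mem_singleton] at hi
    rcases hi with rfl | rfl
    · exact ⟨hac, hbc⟩
    · exact ⟨had, hbd⟩

/-- Two right neighbours of `i` have aligned left sides, so both also touch the leftmost square, and
four contacts alternate. The square `i` need not lie on the chains. -/
theorem eq_of_sideContact_of_ne_leftmost (hW : WeakGeneric r) {i j k : Fin n}
    (hi : i ≠ C.leftmost) (hj : j ∈ C.verts) (hk : k ∈ C.verts) (hij : P.SideContact i j)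
    (hik : P.SideContact i k) : j = k := by
  by_contra hjk
  obtain ⟨h1, h2⟩ := C.sideContact_leftmost_of_left_eq hW hj hk hjk (hij.1.symm.trans hik.1)
  exact not_four_sideContacts hi hjk hij hik h1 h2

theorem eq_of_sideContact_of_ne_rightmost (hW : WeakGeneric r) {i j k : Fin n}
    (hi : i ≠ C.rightmost) (hj : j ∈ C.verts) (hk : k ∈ C.verts) (hji : P.SideContact j i)
    (hki : P.SideContact k i) : j = k := by
  by_contra hjk
  obtain ⟨h1, h2⟩ := C.sideContact_rightmost_of_right_eq hW hj hk hjk (hji.1.trans hki.1.symm)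
  exact not_four_sideContacts hjk hi hji h1 hki h2

theorem not_sideContact_rightmost {i : Fin n} (hi : i ∈ C.verts) :
    ¬ P.SideContact C.rightmost i := by
  intro h
  have h1 := h.1
  have := P.pos C.rightmost
  have := P.pos i
  rcases C.eq_rightmost_or_right_le hi with rfl | h' <;> linarith

theorem eq_of_sideContact_leftmost {i : Fin n} (hi : i ∈ C.verts)
    (h : P.SideContact C.leftmost i) : i = C.U 1 ∨ i = C.D 1 := by
  have h0 : i ≠ C.leftmost := by
    rintro rfl
    exact h.not_symm h
  have hU := (C.U_chain 0 C.p_pos).1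
  have hD := (C.D_chain 0 C.q_pos).1
  rcases C.mem_verts_iff.1 hi with ⟨k, hk, rfl⟩ | ⟨k, hk, rfl⟩
  · left
    rw [C.U_eq_of_left_eq hk C.p_pos (h.1.symm.trans hU)]
  · right
    rw [← C.first] at hD
    rw [C.swap.U_eq_of_left_eq (i := k) (j := 1) hk C.q_pos (h.1.symm.trans hD)]

theorem right_le_of_rot_sideContact {i j : Fin n}
    (h : P.rot.SideContact i j ∨ P.rot.SideContact j i) : P.x j - r j ≤ P.x i + r i := by
  have hi := P.pos i
  have hj := P.pos j
  rcases h with h | h <;> obtain ⟨h1, h2, h3⟩ := h <;> simp only [rot] at h1 h2 h3 <;> linarith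

/-- Every other chain square starts at or beyond the right side of the leftmost one. A vertical
contact would force it to start exactly there; the contact is then horizontal, and the types exclude
each other. -/
theorem not_rot_sideContact_leftmost (hW : WeakGeneric r) {i : Fin n} (hi : i ∈ C.verts) :
    ¬ (P.rot.SideContact C.leftmost i ∨ P.rot.SideContact i C.leftmost) := by
  intro h
  have h1 := right_le_of_rot_sideContact h
  rcases C.eq_leftmost_or_right_le hi with rfl | h2
  · rcases h with h | h <;> exact h.not_symm h
  · have h3 := C.sideContact_leftmost_of_left_eq_right hW hi (le_antisymm h1 h2)
    rcases h with h | h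
    · exact h3.not_rot h
    · exact h3.not_rot_symm h

theorem not_rot_sideContact_rightmost (hW : WeakGeneric r) {i : Fin n} (hi : i ∈ C.verts) :
    ¬ (P.rot.SideContact i C.rightmost ∨ P.rot.SideContact C.rightmost i) := by
  intro h
  have h1 := right_le_of_rot_sideContact h
  rcases C.eq_rightmost_or_right_le hi with rfl | h2
  · rcases h with h | h <;> exact h.not_symm h
  · have h3 := C.sideContact_rightmost_of_right_eq_left hW hi (le_antisymm h2 h1)
    rcases h with h | h
    · exact h3.not_rot h
    · exact h3.not_rot_symm h

/-- A square with a side contact to a further square on its left keeps that square away from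
the leftmost square in the vertical direction. -/
theorem not_rot_sideContact_leftmost_of_sideContact {i w : Fin n} (hi : i ∈ C.verts)
    (hiw : P.SideContact i w) :
    ¬ (P.rot.SideContact C.leftmost w ∨ P.rot.SideContact w C.leftmost) := by
  intro h
  have h1 := right_le_of_rot_sideContact h
  rcases C.eq_leftmost_or_right_le hi with rfl | h2
  · rcases h with h | h
    · exact hiw.not_rot h
    · exact hiw.not_rot_symm h
  · have := hiw.1
    have := P.pos i
    linarith

theorem not_rot_sideContact_rightmost_of_sideContact {i w : Fin n} (hi : i ∈ C.verts)
    (hwi : P.SideContact w i) :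
    ¬ (P.rot.SideContact w C.rightmost ∨ P.rot.SideContact C.rightmost w) := by
  intro h
  have h1 := right_le_of_rot_sideContact h
  rcases C.eq_rightmost_or_right_le hi with rfl | h2
  · rcases h with h | h
    · exact hwi.not_rot h
    · exact hwi.not_rot_symm h
  · have := hwi.1
    have := P.pos i
    linarith

end TwoChains

/-- If side contacts contain a cycle, the contacts between the remaining sides form a forest. -/
theorem TwoChains.isAcyclic_rot (C : P.TwoChains) (hW : WeakGeneric r)
    (hout : ∀ i j, i ∉ C.verts → j ∉ C.verts → i = j) :
    (SimpleGraph.fromRel P.rot.SideContact).IsAcyclic := by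
  by_contra hac
  obtain ⟨m, hm, v, hv, hadj⟩ := exists_cyclic_sequence_of_not_isAcyclic hac
  replace hadj : ∀ t, P.rot.SideContact (v t) (v (t + 1)) ∨ P.rot.SideContact (v (t + 1)) (v t) :=
    fun t => ((SimpleGraph.fromRel_adj _ _ _).1 (hadj t)).2
  have hmiss := (exists_twoChains_of_cycle hW hm hv hadj).1
  -- A square without vertical contacts to the chains has at most one vertical neighbour, the square
  -- off the chains, whereas on a cycle it would have two.
  have key : ∀ c : Fin n, (∀ i ∈ C.verts, ¬ (P.rot.SideContact c i ∨ P.rot.SideContact i c)) →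
      ∀ t, v t ≠ c := by
    rintro c hc t rfl
    have h1 : v (t + 1) ∉ C.verts := fun h => hc _ h (hadj t)
    have h2 : v (t - 1) ∉ C.verts := fun h => hc _ h (by
      have := hadj (t - 1)
      rw [sub_add_cancel] at this
      exact this.symm)
    exact ZMod.add_one_ne_sub_one hm t (hv (hout _ _ h1 h2))
  exact C.leftmost_ne_rightmost (hmiss _ _
    (key _ fun i hi => C.not_rot_sideContact_leftmost hW hi)
    (key _ fun i hi h => C.not_rot_sideContact_rightmost hW hi h.symm))

end SquareConfig

/-! ### Counting contacts -/

namespace SquareConfig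

variable {n : ℕ} {r : Fin n → ℝ} {P : SquareConfig r}

open Classical in
/-- The set of ordered pairs with a side contact. -/
noncomputable def sideContacts (P : SquareConfig r) : Finset (Fin n × Fin n) :=
  {z | P.SideContact z.1 z.2}

theorem card_sideContacts_eq_sum [DecidableRel P.SideContact] :
    #P.sideContacts = ∑ i, #{j | P.SideContact i j} := by
  classical
  simp only [sideContacts, card_filter, Fintype.sum_prod_type]
  exact sum_congr rfl fun i _ => sum_congr rfl fun j _ => by congr

theorem TwoChains.card_leftmost_le [DecidableRel P.SideContact] (C : P.TwoChains) :
    #{j ∈ C.verts | P.SideContact C.leftmost j} ≤ 2 := by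
  refine (card_le_card (t := {C.U 1, C.D 1}) fun j hj => ?_).trans card_le_two
  rw [mem_filter] at hj
  simpa using C.eq_of_sideContact_leftmost hj.1 hj.2

/-- The indicator terms record that the surplus at the leftmost square and the deficit at the
rightmost one cancel in the sum over all squares. -/
theorem TwoChains.card_add_ite_le [DecidableRel P.SideContact] (C : P.TwoChains)
    (hW : WeakGeneric r) (i : Fin n) :
    #{j ∈ C.verts | P.SideContact i j} + (if i = C.rightmost then 1 else 0) ≤
      1 + (if i = C.leftmost then 1 else 0) := by
  by_cases h1 : i = C.leftmost
  · have h2 : i ≠ C.rightmost := h1 ▸ C.leftmost_ne_rightmost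
    rw [if_neg h2, if_pos h1, h1]
    exact C.card_leftmost_le
  · rw [if_neg h1]
    by_cases h2 : i = C.rightmost
    · rw [if_pos h2, h2, filter_eq_empty_iff.2 fun j hj => C.not_sideContact_rightmost hj]
      simp
    · rw [if_neg h2, add_zero, add_zero, card_le_one]
      intro j hj k hk
      rw [mem_filter] at hj hk
      exact C.eq_of_sideContact_of_ne_leftmost hW h1 hj.1 hk.1 hj.2 hk.2

theorem TwoChains.sum_card_le [DecidableRel P.SideContact] (C : P.TwoChains)
    (hW : WeakGeneric r) :
    ∑ i, #{j ∈ C.verts | P.SideContact i j} ≤ n := by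
  have h := sum_le_sum fun i (_ : i ∈ univ) => C.card_add_ite_le hW i
  simp only [sum_add_distrib, sum_ite_eq', mem_univ, if_true, sum_const, card_univ,
    Fintype.card_fin, smul_eq_mul, mul_one] at h
  omega

theorem TwoChains.sum_card_add_one_le [DecidableRel P.SideContact] (C : P.TwoChains)
    (hW : WeakGeneric r) {w : Fin n} (hw : w ∉ C.verts) :
    ∑ i, #{j ∈ C.verts | P.SideContact i j} + 1 ≤
      n + #{j ∈ C.verts | P.SideContact w j} := by
  have h : ∀ i ∈ univ.erase w, #{j ∈ C.verts | P.SideContact i j} +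
      (if i = C.rightmost then 1 else 0) ≤ 1 + (if i = C.leftmost then 1 else 0) :=
    fun i _ => C.card_add_ite_le hW i
  have h1 : C.leftmost ∈ univ.erase w :=
    mem_erase.2 ⟨fun h => hw (h ▸ C.leftmost_mem), mem_univ _⟩
  have h2 : C.rightmost ∈ univ.erase w :=
    mem_erase.2 ⟨fun h => hw (h ▸ C.rightmost_mem), mem_univ _⟩
  have hs := sum_le_sum h
  simp only [sum_add_distrib, sum_ite_eq', h1, h2, if_true, sum_const,
    card_erase_of_mem (mem_univ w), card_univ, Fintype.card_fin, smul_eq_mul, mul_one] at hs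
  rw [← add_sum_erase univ _ (mem_univ w)]
  have := Fin.pos w
  omega

theorem card_sideContacts_add_one_le_of_isAcyclic
    (hac : (SimpleGraph.fromRel P.SideContact).IsAcyclic) (s : Finset (Fin n)) (hs : s.Nonempty)
    (hsupp : ∀ i j, P.SideContact i j → i ∈ s ∧ j ∈ s) : #P.sideContacts + 1 ≤ #s := by
  classical
  have h := card_rel_add_one_le_of_isAcyclic P.SideContact (fun i j h => h.not_symm) hac s hs hsupp
  convert h using 3
  ext
  simp [sideContacts]

/-- If `I` consists of squares among the leftmost and rightmost ones which take part in no contact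
in the rotated configuration, then these contacts number at most `n - 1 - #I`. -/
theorem TwoChains.card_rot_add_le (C : P.TwoChains)
    (hac : (SimpleGraph.fromRel P.rot.SideContact).IsAcyclic) (I : Finset (Fin n))
    (hI : I ⊆ {C.leftmost, C.rightmost})
    (hiso : ∀ i ∈ I, ∀ j, ¬ (P.rot.SideContact i j ∨ P.rot.SideContact j i)) :
    #P.rot.sideContacts + 1 + #I ≤ n := by
  have h := card_sideContacts_add_one_le_of_isAcyclic hac Iᶜ ?_ ?_
  · rw [card_compl, Fintype.card_fin] at h
    have : #I ≤ n := by simpa using card_le_univ I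
    omega
  · obtain ⟨c, hc1, hc2⟩ := C.exists_ne_leftmost_ne_rightmost
    exact ⟨c, mem_compl.2 fun hc => by
      have := hI hc
      simp only [mem_insert, mem_singleton] at this
      tauto⟩
  · intro i j hij
    exact ⟨mem_compl.2 fun h => hiso i h j (Or.inl hij),
      mem_compl.2 fun h => hiso j h i (Or.inr hij)⟩

/-- If the chains contain all squares, there are at most n horizontal contacts, and both extreme
squares are isolated in the vertical forest, leaving it at most n - 3 edges. A square `w` off the
chains needs a finer balance. -/
theorem TwoChains.card_add_card_rot_le (C : P.TwoChains) (hW : WeakGeneric r)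
    (hout : ∀ i j, i ∉ C.verts → j ∉ C.verts → i = j) :
    #P.sideContacts + #P.rot.sideContacts ≤ 2 * n - 2 := by
  classical
  have hac := C.isAcyclic_rot hW hout
  rw [card_sideContacts_eq_sum]
  by_cases hw : ∃ w, w ∉ C.verts
  · obtain ⟨w, hw⟩ := hw
    have hverts : ∀ i, i ≠ w → i ∈ C.verts := fun i hi => by
      by_contra h
      exact hi (hout _ _ h hw)
    have huniv : (univ : Finset (Fin n)) = insert w C.verts := by
      ext i
      by_cases h : i = w <;> simp [h, hverts i]
    have hsplit : ∑ i, #{j | P.SideContact i j} =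
        ∑ i, #{j ∈ C.verts | P.SideContact i j} + #{i | P.SideContact i w} := by
      rw [card_filter (fun i => P.SideContact i w), ← sum_add_distrib]
      refine sum_congr rfl fun i _ => ?_
      rw [card_filter, card_filter]
      nth_rewrite 1 [huniv]
      rw [sum_insert hw, add_comm]
    have hne : ∀ i, P.SideContact i w → i ≠ w := fun i h hi => by
      subst hi
      exact h.not_symm h
    have hin : #{i | P.SideContact i w} ≤ 1 := by
      rw [card_le_one]
      intro i hi j hj
      simp only [mem_filter, mem_univ, true_and] at hi hj
      exact C.eq_of_sideContact_of_ne_rightmost hW (i := w) (fun h => hw (h ▸ C.rightmost_mem))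
        (hverts i (hne i hi)) (hverts j (hne j hj)) hi hj
    have hout : #{j ∈ C.verts | P.SideContact w j} ≤ 1 := by
      rw [card_le_one]
      intro j hj k hk
      rw [mem_filter] at hj hk
      exact C.eq_of_sideContact_of_ne_leftmost hW (i := w) (fun h => hw (h ▸ C.leftmost_mem))
        hj.1 hk.1 hj.2 hk.2
    have hsum := C.sum_card_add_one_le hW hw
    have hleft : (∃ i, P.SideContact i w) → ∀ j,
        ¬ (P.rot.SideContact C.leftmost j ∨ P.rot.SideContact j C.leftmost) := by
      rintro ⟨i, hi⟩ j
      by_cases hj : j = w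
      · subst hj
        exact C.not_rot_sideContact_leftmost_of_sideContact (hverts i (hne i hi)) hi
      · exact C.not_rot_sideContact_leftmost hW (hverts j hj)
    have hright : (∃ i ∈ C.verts, P.SideContact w i) → ∀ j,
        ¬ (P.rot.SideContact C.rightmost j ∨ P.rot.SideContact j C.rightmost) := by
      rintro ⟨i, hiC, hi⟩ j h
      by_cases hj : j = w
      · subst hj
        exact C.not_rot_sideContact_rightmost_of_sideContact hiC hi h.symm
      · exact C.not_rot_sideContact_rightmost hW (hverts j hj) h.symm
    have hleft' : #{i | P.SideContact i w} = 0 ∨ ∃ i, P.SideContact i w := by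
      rw [or_iff_not_imp_left]
      intro h
      obtain ⟨i, hi⟩ := card_pos.1 (Nat.pos_of_ne_zero h)
      exact ⟨i, by simpa using hi⟩
    have hright' : #{j ∈ C.verts | P.SideContact w j} = 0 ∨ ∃ i ∈ C.verts, P.SideContact w i := by
      rw [or_iff_not_imp_left]
      intro h
      obtain ⟨i, hi⟩ := card_pos.1 (Nat.pos_of_ne_zero h)
      exact ⟨i, by simpa using hi⟩
    rw [hsplit]
    -- Horizontal contacts number at most n - 1, plus one for each side on which `w` has a
    -- horizontal contact. A contact on the left of `w` isolates the leftmost square vertically, one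
    -- on the right the rightmost square, so each surplus costs the forest an edge.
    rcases hleft' with hl | hl <;> rcases hright' with hr | hr
    · have := C.card_rot_add_le hac ∅ (by simp) (by simp)
      omega
    · have := C.card_rot_add_le hac {C.rightmost} (by simp) (by simpa using hright hr)
      rw [card_singleton] at this
      omega
    · have := C.card_rot_add_le hac {C.leftmost} (by simp) (by simpa using hleft hl)
      rw [card_singleton] at this
      omega
    · have := C.card_rot_add_le hac {C.leftmost, C.rightmost} subset_rfl (by
        intro i hi
        simp only [mem_insert, mem_singleton] at hi
        rcases hi with rfl | rfl
        · exact hleft hl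
        · exact hright hr)
      rw [card_pair C.leftmost_ne_rightmost] at this
      omega
  · push Not at hw
    have huniv : C.verts = univ := by
      ext i
      simp [hw i]
    have hsum := C.sum_card_le hW
    rw [huniv] at hsum
    have := C.card_rot_add_le hac {C.leftmost, C.rightmost} subset_rfl (by
        intro i hi j
        simp only [mem_insert, mem_singleton] at hi
        rcases hi with rfl | rfl
        · exact C.not_rot_sideContact_leftmost hW (hw j)
        · exact fun h => C.not_rot_sideContact_rightmost hW (hw j) h.symm)
    rw [card_pair C.leftmost_ne_rightmost] at this
    omega

theorem card_add_card_rot_le_of_not_isAcyclic (hW : WeakGeneric r)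
    (h : ¬ (SimpleGraph.fromRel P.SideContact).IsAcyclic) :
    #P.sideContacts + #P.rot.sideContacts ≤ 2 * n - 2 := by
  obtain ⟨m, hm, v, hv, hadj⟩ := exists_cyclic_sequence_of_not_isAcyclic h
  obtain ⟨hmiss, C, hC⟩ := exists_twoChains_of_cycle hW hm hv
    fun t => ((SimpleGraph.fromRel_adj _ _ _).1 (hadj t)).2
  have hne : ∀ i, i ∉ C.verts → ∀ t, v t ≠ i := fun i hi t h => hi (h ▸ hC t)
  exact C.card_add_card_rot_le hW fun i j hi hj => hmiss i j (hne i hi) (hne j hj)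

theorem rot_rot_sideContact (i j : Fin n) :
    P.rot.rot.SideContact i j ↔ P.SideContact j i := by
  simp only [SideContact, rot]
  constructor <;> rintro ⟨h1, h2, h3⟩ <;> refine ⟨?_, ?_, ?_⟩ <;> linarith

theorem card_rot_rot_sideContacts : #P.rot.rot.sideContacts = #P.sideContacts := by
  classical
  refine card_bij (fun z _ => z.swap) ?_ (fun a _ b _ h => Prod.swap_injective h) ?_
  · rintro ⟨i, j⟩ h
    simpa [sideContacts, rot_rot_sideContact] using h
  · rintro ⟨i, j⟩ h
    exact ⟨(j, i), by simpa [sideContacts, rot_rot_sideContact] using h, rfl⟩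

/-- Under the weak generic condition there are at most `2 n - 2` contacts. -/
theorem card_add_card_rot_le (hn : 1 ≤ n) (hW : WeakGeneric r) :
    #P.sideContacts + #P.rot.sideContacts ≤ 2 * n - 2 := by
  by_cases h1 : (SimpleGraph.fromRel P.SideContact).IsAcyclic
  · by_cases h2 : (SimpleGraph.fromRel P.rot.SideContact).IsAcyclic
    · have hs : (univ : Finset (Fin n)).Nonempty := ⟨⟨0, hn⟩, mem_univ _⟩
      have e1 := card_sideContacts_add_one_le_of_isAcyclic h1 univ hs (by simp)
      have e2 := card_sideContacts_add_one_le_of_isAcyclic h2 univ hs (by simp)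
      rw [card_univ, Fintype.card_fin] at e1 e2
      omega
    · have := card_add_card_rot_le_of_not_isAcyclic hW h2
      rw [card_rot_rot_sideContacts] at this
      omega
  · exact card_add_card_rot_le_of_not_isAcyclic hW h1

end SquareConfig

/-! ### From packings to coordinates -/

theorem homotheticCopy_stdSquare {r : ℝ} (hr : 0 < r) (p : ℝ × ℝ) :
    homotheticCopy stdSquare r p = Set.Icc (p.1 - r) (p.1 + r) ×ˢ Set.Icc (p.2 - r) (p.2 + r) := by
  ext ⟨a, b⟩
  simp only [homotheticCopy, stdSquare, Set.mem_ofPred_eq, Set.mem_prod, Set.mem_Icc]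
  constructor
  · rintro ⟨⟨c, d⟩, ⟨⟨h1, h2⟩, h3, h4⟩, h⟩
    simp only [Prod.ext_iff, Prod.smul_mk, Prod.fst_add, Prod.snd_add, smul_eq_mul] at h h1 h2 h3 h4
    obtain ⟨rfl, rfl⟩ := h
    refine ⟨⟨?_, ?_⟩, ?_, ?_⟩ <;> nlinarith
  · rintro ⟨⟨h1, h2⟩, h3, h4⟩
    refine ⟨((a - p.1) / r, (b - p.2) / r), ⟨⟨?_, ?_⟩, ?_, ?_⟩, ?_⟩
    · rw [le_div_iff₀ hr]; linarith
    · rw [div_le_iff₀ hr]; linarith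
    · rw [le_div_iff₀ hr]; linarith
    · rw [div_le_iff₀ hr]; linarith
    · ext
      · simp only [Prod.smul_mk, Prod.fst_add, smul_eq_mul]; field_simp; ring
      · simp only [Prod.smul_mk, Prod.snd_add, smul_eq_mul]; field_simp; ring

theorem interior_homotheticCopy_stdSquare {r : ℝ} (hr : 0 < r) (p : ℝ × ℝ) :
    interior (homotheticCopy stdSquare r p) =
      Set.Ioo (p.1 - r) (p.1 + r) ×ˢ Set.Ioo (p.2 - r) (p.2 + r) := by
  rw [homotheticCopy_stdSquare hr, interior_prod_eq, interior_Icc, interior_Icc]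

theorem disjoint_interior_homotheticCopy_iff {r s : ℝ} (hr : 0 < r) (hs : 0 < s) (p q : ℝ × ℝ) :
    Disjoint (interior (homotheticCopy stdSquare r p)) (interior (homotheticCopy stdSquare s q)) ↔
      p.1 + r ≤ q.1 - s ∨ q.1 + s ≤ p.1 - r ∨ p.2 + r ≤ q.2 - s ∨ q.2 + s ≤ p.2 - r := by
  rw [interior_homotheticCopy_stdSquare hr, interior_homotheticCopy_stdSquare hs,
    Set.disjoint_prod]
  have key : ∀ a b : ℝ, Disjoint (Set.Ioo (a - r) (a + r)) (Set.Ioo (b - s) (b + s)) ↔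
      a + r ≤ b - s ∨ b + s ≤ a - r := by
    intro a b
    rw [Set.disjoint_iff_inter_eq_empty, Set.Ioo_inter_Ioo, Set.Ioo_eq_empty_iff, not_lt,
      min_le_iff, le_max_iff, le_max_iff]
    constructor
    · rintro ((h | h) | (h | h))
      · linarith
      · exact Or.inl h
      · exact Or.inr h
      · linarith
    · rintro (h | h)
      · exact Or.inl (Or.inr h)
      · exact Or.inr (Or.inl h)
  rw [key, key, or_assoc]

theorem inter_homotheticCopy_nonempty_iff {r s : ℝ} (hr : 0 < r) (hs : 0 < s) (p q : ℝ × ℝ) :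
    (homotheticCopy stdSquare r p ∩ homotheticCopy stdSquare s q).Nonempty ↔
      (p.1 - r ≤ q.1 + s ∧ q.1 - s ≤ p.1 + r) ∧ (p.2 - r ≤ q.2 + s ∧ q.2 - s ≤ p.2 + r) := by
  have key : ∀ a b : ℝ, (Set.Icc (a - r) (a + r) ∩ Set.Icc (b - s) (b + s)).Nonempty ↔
      a - r ≤ b + s ∧ b - s ≤ a + r := by
    intro a b
    rw [Set.Icc_inter_Icc, Set.nonempty_Icc, max_le_iff, le_min_iff, le_min_iff]
    constructor
    · rintro ⟨⟨_, h1⟩, h2, _⟩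
      exact ⟨h1, h2⟩
    · rintro ⟨h1, h2⟩
      exact ⟨⟨by linarith, h1⟩, h2, by linarith⟩
  rw [homotheticCopy_stdSquare hr, homotheticCopy_stdSquare hs, Set.prod_inter_prod,
    Set.prod_nonempty_iff, key, key]

namespace HomotheticSquarePacking

variable {n : ℕ} {r : Fin n → ℝ} (P : HomotheticSquarePacking r)

/-- The coordinates of the centres of a packing. -/
def toConfig : SquareConfig r where
  x i := (P.center i).1
  y i := (P.center i).2
  pos := P.radius_pos
  sep i j hij := (disjoint_interior_homotheticCopy_iff (P.radius_pos i) (P.radius_pos j) _ _).1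
    (P.disjoint_interiors i j hij)

theorem numContacts_le_card_add_card :
    P.numContacts ≤ #P.toConfig.sideContacts + #P.toConfig.rot.sideContacts := by
  classical
  have hsub : P.contactGraph.edgeSet ⊆
      ((P.toConfig.sideContacts ∪ P.toConfig.rot.sideContacts).image fun z => s(z.1, z.2) :
        Finset (Sym2 (Fin n))) := by
    intro e
    induction e using Sym2.ind with
    | _ i j =>
      rintro ⟨hij, h⟩
      obtain ⟨⟨h1, h2⟩, h3, h4⟩ :=
        (inter_homotheticCopy_nonempty_iff (P.radius_pos i) (P.radius_pos j) _ _).1 h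
      simp only [SquareConfig.sideContacts, coe_image, Set.mem_image, mem_coe, mem_union,
        mem_filter, mem_univ, true_and, Prod.exists]
      rcases P.toConfig.sideContact_of_touch hij h1 h2 h3 h4 with (h | h) | (h | h)
      · exact ⟨i, j, Or.inl h, rfl⟩
      · exact ⟨j, i, Or.inl h, Sym2.eq_swap⟩
      · exact ⟨i, j, Or.inr h, rfl⟩
      · exact ⟨j, i, Or.inr h, Sym2.eq_swap⟩
  calc P.numContacts ≤ _ := Set.ncard_le_ncard hsub (finite_toSet _)
    _ ≤ _ := by
      rw [Set.ncard_coe_finset]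
      exact card_image_le.trans (card_union_le _ _)

theorem numContacts_le_of_weakGeneric (hn : 1 ≤ n) (hW : WeakGeneric r) :
    P.numContacts ≤ 2 * n - 2 :=
  P.numContacts_le_card_add_card.trans (SquareConfig.card_add_card_rot_le hn hW)

end HomotheticSquarePacking

/-! ### Two-row packings with 2n - 1 contacts -/

/-- Squares with indices in `s` standing on, or hanging from, a common horizontal line. The square
`i` meets the line in the interval `[left i, left i + 2 r i]`; the upper and the lower row reach
from `0` or further left to `R true` and `R false`. A set of contacts is recorded. -/
structure TwoRows {n : ℕ} (r : Fin n → ℝ) (s : Finset (Fin n)) (R : Bool → ℝ) where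
  left : Fin n → ℝ
  row : Fin n → Bool
  contacts : Finset (Sym2 (Fin n))
  nonneg : ∀ b, 0 ≤ R b
  right_le : ∀ i ∈ s, left i + 2 * r i ≤ R (row i)
  sep : ∀ i ∈ s, ∀ j ∈ s, i ≠ j → row i = row j →
    left i + 2 * r i ≤ left j ∨ left j + 2 * r j ≤ left i
  cover : ∀ b t, 0 ≤ t → t ≤ R b → ∃ i ∈ s, row i = b ∧ left i ≤ t ∧ t ≤ left i + 2 * r i
  touch : ∀ e ∈ contacts, ∃ i ∈ s, ∃ j ∈ s, i ≠ j ∧ left i ≤ left j + 2 * r j ∧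
    left j ≤ left i + 2 * r i ∧ e = s(i, j)

namespace TwoRows

variable {n : ℕ} {r : Fin n → ℝ} {s : Finset (Fin n)} {R : Bool → ℝ}

/-- Append the square `k` to the row `b`; the squares in `N` meet the end of that row. -/
def append (S : TwoRows r s R) (k : Fin n) (hk : k ∉ s) (hr : 0 < r k) (b : Bool)
    (N : Finset (Fin n)) (hNs : N ⊆ s)
    (hN : ∀ i ∈ N, S.left i ≤ R b ∧ R b ≤ S.left i + 2 * r i) :
    TwoRows r (insert k s) (Function.update R b (R b + 2 * r k)) where
  left := Function.update S.left k (R b)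
  row := Function.update S.row k b
  contacts := S.contacts ∪ N.image fun i => s(k, i)
  nonneg c := by
    by_cases h : c = b
    · subst h
      have := S.nonneg c
      rw [Function.update_self]
      linarith
    · rw [Function.update_of_ne h]
      exact S.nonneg c
  right_le i hi := by
    by_cases hik : i = k
    · subst hik
      simp
    · have his := (mem_insert.1 hi).resolve_left hik
      rw [Function.update_of_ne hik, Function.update_of_ne hik]
      have := S.right_le i his
      by_cases hb : S.row i = b
      · rw [hb, Function.update_self]
        rw [hb] at this
        linarith
      · rwa [Function.update_of_ne hb]
  sep i hi j hj hij hrow := by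
    by_cases hik : i = k
    · subst hik
      have hjs := (mem_insert.1 hj).resolve_left hij.symm
      rw [Function.update_self, Function.update_of_ne hij.symm] at hrow ⊢
      right
      have := S.right_le j hjs
      rwa [← hrow] at this
    · have his := (mem_insert.1 hi).resolve_left hik
      by_cases hjk : j = k
      · subst hjk
        rw [Function.update_self, Function.update_of_ne hij] at hrow ⊢
        left
        have := S.right_le i his
        rwa [hrow] at this
      · have hjs := (mem_insert.1 hj).resolve_left hjk
        rw [Function.update_of_ne hik, Function.update_of_ne hjk] at hrow ⊢
        exact S.sep i his j hjs hij hrow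
  cover c t h0 ht := by
    by_cases h : t ≤ R c
    · obtain ⟨i, hi, h1, h2, h3⟩ := S.cover c t h0 h
      have hik : i ≠ k := fun h => hk (h ▸ hi)
      refine ⟨i, mem_insert_of_mem hi, ?_⟩
      rw [Function.update_of_ne hik, Function.update_of_ne hik]
      exact ⟨h1, h2, h3⟩
    · have hc : c = b := by
        by_contra hc
        rw [Function.update_of_ne hc] at ht
        exact h ht
      subst hc
      rw [Function.update_self] at ht
      refine ⟨k, mem_insert_self _ _, ?_⟩
      rw [Function.update_self, Function.update_self]
      exact ⟨rfl, by linarith, ht⟩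
  touch e he := by
    rcases mem_union.1 he with he | he
    · obtain ⟨i, hi, j, hj, hij, h1, h2, rfl⟩ := S.touch e he
      have hik : i ≠ k := fun h => hk (h ▸ hi)
      have hjk : j ≠ k := fun h => hk (h ▸ hj)
      refine ⟨i, mem_insert_of_mem hi, j, mem_insert_of_mem hj, hij, ?_⟩
      rw [Function.update_of_ne hik, Function.update_of_ne hjk]
      exact ⟨h1, h2, rfl⟩
    · obtain ⟨i, hi, rfl⟩ := mem_image.1 he
      have hik : i ≠ k := fun h => hk (h ▸ hNs hi)
      obtain ⟨h1, h2⟩ := hN i hi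
      refine ⟨k, mem_insert_self _ _, i, mem_insert_of_mem (hNs hi), hik.symm, ?_⟩
      rw [Function.update_self, Function.update_of_ne hik]
      exact ⟨h2, by linarith, rfl⟩

theorem card_append (S : TwoRows r s R) (k : Fin n) (hk : k ∉ s) (hr : 0 < r k) (b : Bool)
    (N : Finset (Fin n)) (hNs : N ⊆ s)
    (hN : ∀ i ∈ N, S.left i ≤ R b ∧ R b ≤ S.left i + 2 * r i) :
    #(S.append k hk hr b N hNs hN).contacts = #S.contacts + #N := by
  simp only [append]
  rw [card_union_of_disjoint, card_image_of_injective]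
  · intro i j h
    have h' : i = j ∨ k = j ∧ i = k := by simpa using h
    rcases h' with h' | ⟨h1, h2⟩
    · exact h'
    · exact h2.trans h1
  · rw [disjoint_left]
    intro e he he'
    obtain ⟨i, hi, j, hj, -, -, -, rfl⟩ := S.touch e he
    obtain ⟨l, hl, h⟩ := mem_image.1 he'
    rcases Sym2.eq_iff.1 h with ⟨rfl, -⟩ | ⟨rfl, -⟩
    · exact hk hi
    · exact hk hj

variable (r s R) in
/-- There is a two-row arrangement of the squares in `s` with row ends `R` and at least
`2 #s - 3 + β` contacts. -/
def HasExcess (β : ℕ) : Prop := ∃ S : TwoRows r s R, 2 * #s + β ≤ #S.contacts + 3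

variable {β : ℕ}

/-- Appending a square to the shorter row creates two contacts. -/
theorem HasExcess.append (h : HasExcess r s R β) {k : Fin n} (hk : k ∉ s) (hr : 0 < r k) (b : Bool)
    (hb : R b ≤ R !b) : HasExcess r (insert k s) (Function.update R b (R b + 2 * r k)) β := by
  obtain ⟨S, hS⟩ := h
  obtain ⟨i, hi, hib, hi1, hi2⟩ := S.cover b (R b) (S.nonneg b) le_rfl
  obtain ⟨j, hj, hjb, hj1, hj2⟩ := S.cover (!b) (R b) (S.nonneg b) hb
  have hij : i ≠ j := by
    rintro rfl
    rw [hib] at hjb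
    simp at hjb
  refine ⟨S.append k hk hr b {i, j} (by simp [insert_subset_iff, hi, hj]) ?_, ?_⟩
  · intro l hl
    simp only [mem_insert, mem_singleton] at hl
    rcases hl with rfl | rfl
    · exact ⟨hi1, hi2⟩
    · exact ⟨hj1, hj2⟩
  · rw [card_append, card_pair hij, card_insert_of_notMem hk]
    omega

/-- Appending a square to either row when both rows end at the same point creates five contacts. -/
theorem HasExcess.append_both (h : HasExcess r s R β) {k l : Fin n} (hk : k ∉ s) (hl : l ∉ s)
    (hkl : k ≠ l) (hrk : 0 < r k) (hrl : 0 < r l) (hR : R true = R false) :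
    HasExcess r (insert l (insert k s))
      (Function.update (Function.update R true (R true + 2 * r k)) false (R false + 2 * r l))
      (β + 1) := by
  obtain ⟨S, hS⟩ := h
  obtain ⟨i, hi, hib, hi1, hi2⟩ := S.cover true (R true) (S.nonneg _) le_rfl
  obtain ⟨j, hj, hjb, hj1, hj2⟩ := S.cover false (R true) (S.nonneg _) hR.le
  have hij : i ≠ j := by
    rintro rfl
    rw [hib] at hjb
    simp at hjb
  have hik : i ≠ k := fun h => hk (h ▸ hi)
  have hjk : j ≠ k := fun h => hk (h ▸ hj)
  have hl' : l ∉ insert k s := by simp [hkl.symm, hl]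
  set S' := S.append k hk hrk true {i, j} (by simp [insert_subset_iff, hi, hj]) (by
    intro l hl
    simp only [mem_insert, mem_singleton] at hl
    rcases hl with rfl | rfl
    · exact ⟨hi1, hi2⟩
    · exact ⟨hj1, hj2⟩) with hS'
  have hc := S.card_append k hk hrk true {i, j} (by simp [insert_subset_iff, hi, hj]) (by
    intro l hl
    simp only [mem_insert, mem_singleton] at hl
    rcases hl with rfl | rfl
    · exact ⟨hi1, hi2⟩
    · exact ⟨hj1, hj2⟩)
  rw [← hS', card_pair hij] at hc
  have hRf : Function.update R true (R true + 2 * r k) false = R false := by simp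
  -- As the rows were level, `l` meets the ends `i` and `j` of both rows and also `k`, which starts
  -- at the same point on the other side of the line.
  have hN : ∀ a ∈ ({k, i, j} : Finset (Fin n)),
      S'.left a ≤ Function.update R true (R true + 2 * r k) false ∧
      Function.update R true (R true + 2 * r k) false ≤ S'.left a + 2 * r a := by
    intro a ha
    rw [hRf, ← hR]
    simp only [hS', TwoRows.append]
    simp only [mem_insert, mem_singleton] at ha
    rcases ha with rfl | rfl | rfl
    · rw [Function.update_self]
      exact ⟨le_rfl, by linarith⟩
    · rw [Function.update_of_ne hik]
      exact ⟨hi1, hi2⟩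
    · rw [Function.update_of_ne hjk]
      exact ⟨hj1, hj2⟩
  have hsub : ({k, i, j} : Finset (Fin n)) ⊆ insert k s := by
    simp [insert_subset_iff, hi, hj]
  have hc' := S'.card_append l hl' hrl false {k, i, j} hsub hN
  rw [card_insert_of_notMem (by simp [hik.symm, hjk.symm]), card_pair hij] at hc'
  have hex : HasExcess r (insert l (insert k s)) _ (β + 1) :=
    ⟨S'.append l hl' hrl false {k, i, j} hsub hN, by
      rw [hc', hc, card_insert_of_notMem hl', card_insert_of_notMem hk]
      omega⟩
  rwa [hRf] at hex

theorem hasExcess_pair {k l : Fin n} (hkl : k ≠ l) (hrk : 0 < r k) (hrl : 0 < r l) :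
    HasExcess r {k, l} (fun _ => 0) 0 := by
  -- Both squares end at 0, so the rows start level whatever the two radii are; the single contact
  -- is 2 · 2 - 3.
  refine ⟨⟨fun i => -(2 * r i), fun i => decide (i = k), {s(k, l)}, fun _ => le_rfl, by simp,
    ?_, ?_, ?_⟩, ?_⟩
  · intro i hi j hj hij h
    simp only [mem_insert, mem_singleton] at hi hj
    rcases hi with rfl | rfl <;> rcases hj with rfl | rfl
    · exact absurd rfl hij
    · simp [hkl.symm] at h
    · simp [hkl.symm] at h
    · exact absurd rfl hij
  · intro b t h0 ht
    obtain rfl : t = 0 := le_antisymm ht h0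
    cases b
    · exact ⟨l, by simp, by simp [hkl.symm], by linarith, by linarith⟩
    · exact ⟨k, by simp, by simp, by linarith, by linarith⟩
  · intro e he
    refine ⟨k, by simp, l, by simp, hkl, by linarith, by linarith, by simpa using he⟩
  · rw [card_pair hkl, card_singleton]

theorem HasExcess.fill (hr : ∀ i, 0 < r i) (h : HasExcess r s R β) :
    ∃ R', HasExcess r univ R' β := by
  induction hm : #sᶜ generalizing s R with
  | zero =>
    rw [card_eq_zero, compl_eq_empty_iff] at hm
    exact ⟨R, hm ▸ h⟩
  | succ m ih =>
    obtain ⟨k, hk⟩ := card_pos.1 (by omega : 0 < #sᶜ)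
    have hk' := mem_compl.1 hk
    have hcard : #(insert k s)ᶜ = m := by
      rw [compl_insert, card_erase_of_mem hk, hm]
      rfl
    rcases le_total (R true) (R false) with hR | hR
    · exact ih (h.append hk' (hr k) true hR) hcard
    · exact ih (h.append hk' (hr k) false hR) hcard

/-- Greedy extension by two families of squares which make the rows end at the same point. -/
theorem HasExcess.balance (hr : ∀ i, 0 < r i) (h : HasExcess r s R β) (A B : Finset (Fin n))
    (hA : Disjoint A s) (hB : Disjoint B s) (hAB : Disjoint A B)
    (hsum : R true + 2 * ∑ i ∈ A, r i = R false + 2 * ∑ i ∈ B, r i) :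
    ∃ R', R' true = R' false ∧ HasExcess r (A ∪ B ∪ s) R' β := by
  induction hm : #A + #B generalizing s R A B with
  | zero =>
    obtain rfl : A = ∅ := card_eq_zero.1 (by omega)
    obtain rfl : B = ∅ := card_eq_zero.1 (by omega)
    refine ⟨R, by simpa using hsum, by simpa using h⟩
  | succ m ih =>
    have stepA : A.Nonempty → R true ≤ R false →
        ∃ R', R' true = R' false ∧ HasExcess r (A ∪ B ∪ s) R' β := by
      rintro ⟨k, hk⟩ hR
      have hks := disjoint_left.1 hA hk
      have hkB := disjoint_left.1 hAB hk
      have := ih (h.append hks (hr k) true hR) (A.erase k) B ?_ ?_ ?_ ?_ ?_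
      · have e : A.erase k ∪ B ∪ insert k s = A ∪ B ∪ s := by
          rw [union_insert, ← insert_union, ← insert_union, insert_erase hk]
        rwa [e] at this
      · rw [disjoint_insert_right]
        exact ⟨notMem_erase k A, hA.mono_left (erase_subset _ _)⟩
      · rw [disjoint_insert_right]
        exact ⟨hkB, hB⟩
      · exact hAB.mono_left (erase_subset _ _)
      · rw [← add_sum_erase A r hk] at hsum
        simp only [Function.update_self, Function.update_of_ne Bool.false_ne_true]
        linarith
      · have := card_erase_add_one hk
        omega
    have stepB : B.Nonempty → R false ≤ R true →
        ∃ R', R' true = R' false ∧ HasExcess r (A ∪ B ∪ s) R' β := by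
      rintro ⟨k, hk⟩ hR
      have hks := disjoint_left.1 hB hk
      have hkA := disjoint_right.1 hAB hk
      have := ih (h.append hks (hr k) false hR) A (B.erase k) ?_ ?_ ?_ ?_ ?_
      · have e : A ∪ B.erase k ∪ insert k s = A ∪ B ∪ s := by
          rw [union_insert, ← insert_union, ← union_insert, insert_erase hk]
        rwa [e] at this
      · rw [disjoint_insert_right]
        exact ⟨hkA, hA⟩
      · rw [disjoint_insert_right]
        exact ⟨notMem_erase k B, hB.mono_left (erase_subset _ _)⟩
      · exact hAB.mono_right (erase_subset _ _)
      · rw [← add_sum_erase B r hk] at hsum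
        simp only [Function.update_self, Function.update_of_ne Bool.false_ne_true.symm]
        linarith
      · have := card_erase_add_one hk
        omega
    -- Once one family is used up, positivity of the other sum shows that the remaining squares
    -- belong to the shorter row.
    have posA : A.Nonempty → 0 < ∑ i ∈ A, r i := fun h => sum_pos (fun i _ => hr i) h
    have posB : B.Nonempty → 0 < ∑ i ∈ B, r i := fun h => sum_pos (fun i _ => hr i) h
    rcases A.eq_empty_or_nonempty with hA0 | hA0 <;> rcases B.eq_empty_or_nonempty with hB0 | hB0
    · simp [hA0, hB0] at hm
    · refine stepB hB0 ?_
      have := posB hB0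
      rw [hA0, sum_empty] at hsum
      linarith
    · refine stepA hA0 ?_
      have := posA hA0
      rw [hB0, sum_empty] at hsum
      linarith
    · rcases le_total (R true) (R false) with hR | hR
      · exact stepA hA0 hR
      · exact stepB hB0 hR

/-- The packing given by an arrangement of all squares. -/
def toPacking (S : TwoRows r univ R) (hr : ∀ i, 0 < r i) : HomotheticSquarePacking r where
  center i := (S.left i + r i, if S.row i then r i else -r i)
  radius_pos := hr
  disjoint_interiors i j hij := by
    rw [disjoint_interior_homotheticCopy_iff (hr i) (hr j)]
    simp only
    by_cases h : S.row i = S.row j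
    · rcases S.sep i (mem_univ i) j (mem_univ j) hij h with h | h
      · left; linarith
      · right; left; linarith
    · right; right
      cases hi : S.row i <;> cases hj : S.row j <;> simp [hi, hj] at h ⊢

theorem card_contacts_le_numContacts (S : TwoRows r univ R) (hr : ∀ i, 0 < r i) :
    #S.contacts ≤ (S.toPacking hr).numContacts := by
  rw [HomotheticSquarePacking.numContacts, ← Set.ncard_coe_finset]
  refine Set.ncard_le_ncard (fun e he => ?_) (Set.toFinite _)
  obtain ⟨i, -, j, -, hij, h1, h2, rfl⟩ := S.touch e he
  refine ⟨hij, (inter_homotheticCopy_nonempty_iff (hr i) (hr j) _ _).2 ?_⟩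
  have := hr i
  have := hr j
  simp only [toPacking]
  refine ⟨⟨by linarith, by linarith⟩, ?_⟩
  split_ifs <;> constructor <;> linarith

end TwoRows

open TwoRows in
/-- A nontrivial relation with four zeroes yields a packing with at least `2 n - 1` contacts. -/
theorem exists_packing_of_not_weakGeneric {n : ℕ} {r : Fin n → ℝ} (hr : ∀ i, 0 < r i)
    (h : ¬ WeakGeneric r) : ∃ P : HomotheticSquarePacking r, 2 * n ≤ P.numContacts + 1 := by
  unfold WeakGeneric at h
  push Not at h
  obtain ⟨σ, hσ, hcard, hsum, i₀, hi₀⟩ := h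
  set A : Finset (Fin n) := {i | σ i = 1} with hA
  set B : Finset (Fin n) := {i | σ i = -1} with hB
  have hsumAB : ∑ i ∈ A, r i = ∑ i ∈ B, r i := by
    have e : ∀ i, (σ i : ℝ) * r i = (if σ i = 1 then r i else 0) - (if σ i = -1 then r i else 0) := by
      intro i
      rcases hσ i with h | h | h <;> simp [h]
    rw [sum_congr rfl fun i _ => e i, sum_sub_distrib, ← sum_filter, ← sum_filter] at hsum
    exact sub_eq_zero.1 hsum
  have hne : A.Nonempty ∧ B.Nonempty := by
    have key : ∀ C : Finset (Fin n), C.Nonempty ↔ 0 < ∑ i ∈ C, r i := by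
      intro C
      refine ⟨fun h => sum_pos (fun i _ => hr i) h, fun h => ?_⟩
      by_contra hC
      rw [not_nonempty_iff_eq_empty.1 hC, sum_empty] at h
      exact lt_irrefl _ h
    have hAB : A.Nonempty ↔ B.Nonempty := by rw [key, key, hsumAB]
    rcases hσ i₀ with h | h | h
    · have : B.Nonempty := ⟨i₀, by simpa [hB] using h⟩
      exact ⟨hAB.2 this, this⟩
    · exact absurd h hi₀
    · have : A.Nonempty := ⟨i₀, by simpa [hA] using h⟩
      exact ⟨this, hAB.1 this⟩
  obtain ⟨⟨a, ha⟩, b, hb⟩ := hne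
  have hdisj : Disjoint A B := by
    rw [disjoint_left]
    intro i h1 h2
    simp only [hA, hB, mem_filter, mem_univ, true_and] at h1 h2
    omega
  set z := orderEmbOfCardLe _ hcard with hz
  have hz0 : ∀ k, σ (z k) = 0 := fun k => by
    simpa using orderEmbOfCardLe_mem _ hcard k
  have hzne : ∀ k l, k ≠ l → z k ≠ z l := fun k l h => z.injective.ne h
  have hzA : ∀ k, z k ∉ A := fun k h => by simp [hA, hz0] at h
  have hzB : ∀ k, z k ∉ B := fun k h => by simp [hB, hz0] at h
  have ne_of_mem : ∀ {C : Finset (Fin n)} {i j : Fin n}, i ∈ C → j ∉ C → i ≠ j :=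
    fun h1 h2 h => h2 (h ▸ h1)
  have hab : a ≠ b := ne_of_mem ha (disjoint_right.1 hdisj hb)
  -- The rows are level at 0, where `a` and `b` give the first gain, and again when both families
  -- are used up, where `z 2` and `z 3` give the second. The excess goes 0, 1, 1, 2.
  have h1 := hasExcess_pair (r := r) (hzne 0 1 (by decide)) (hr _) (hr _)
  have h2 := h1.append_both (k := a) (l := b)
    (by simp [ne_of_mem ha (hzA _)]) (by simp [ne_of_mem hb (hzB _)]) hab (hr _) (hr _) rfl
  obtain ⟨R, hR, h3⟩ := h2.balance hr (A.erase a) (B.erase b)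
    (by
      simp only [disjoint_insert_right, disjoint_singleton_right, mem_erase, hzA,
        disjoint_right.1 hdisj hb]
      simp)
    (by
      simp only [disjoint_insert_right, disjoint_singleton_right, mem_erase, hzB,
        disjoint_left.1 hdisj ha]
      simp)
    (hdisj.mono (erase_subset _ _) (erase_subset _ _))
    (by
      rw [← add_sum_erase A r ha, ← add_sum_erase B r hb] at hsumAB
      simp
      linarith)
  have hz' : ∀ k, k ≠ 0 → k ≠ 1 →
      z k ∉ A.erase a ∪ B.erase b ∪ insert b (insert a {z 0, z 1}) := by
    intro k hk0 hk1
    simp [hzA, hzB, hzne k 0 hk0, hzne k 1 hk1, (ne_of_mem ha (hzA k)).symm,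
      (ne_of_mem hb (hzB k)).symm]
  have h4 := h3.append_both (hz' 2 (by decide) (by decide)) (hz' 3 (by decide) (by decide))
    (hzne 2 3 (by decide)) (hr _) (hr _) hR
  obtain ⟨R', S, hS⟩ := h4.fill hr
  refine ⟨S.toPacking hr, ?_⟩
  have := S.card_contacts_le_numContacts hr
  rw [card_univ, Fintype.card_fin] at hS
  omega

theorem theorem1 (n : ℕ) (hn : 1 ≤ n) (r : Fin n → ℝ) (hr : ∀ i, 0 < r i) :
    (∀ P : HomotheticSquarePacking r, P.numContacts ≤ 2 * n - 2) ↔ WeakGeneric r := by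
  constructor
  · intro h
    by_contra hW
    obtain ⟨P, hP⟩ := exists_packing_of_not_weakGeneric hr hW
    have := h P
    omega
  · exact fun hW P => P.numContacts_le_of_weakGeneric hn hW
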